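/- Let $n\ge 1$, $0<\beta<1$, $0<\alpha<n$, $\alpha+\beta<n$, and let $b:\mathbb R^n\to\mathbb R$ be locally integrable. Cubes $Q\subset\mathbb R^n$ are non-degenerate with sides parallel to the coordinate axes, $|Q|$ is Lebesgue measure, $\chi_Q$ is the characteristic function of $Q$ and $b_Q=|Q|^{-1}\int_Q b$. Put $$M(f)(x)=\sup_{Q\ni x}\frac1{|Q|}\int_Q|f(y)|\,dy,\qquad M_{\alpha,b}(f)(x)=\sup_{Q\ni x}\frac1{|Q|^{1-\alpha/n}}\int_Q|b(x)-b(y)|\,|f(y)|\,dy .$$ For a measurable $p(\cdot):\mathbb R^n\to[1,\infty)$ let $L^{p(\cdot)}$ be the set of measurable $f$ with $\int_{\mathbb R^n}(|f(x)|/\lambda)^{p(x)}\,dx<\infty$ for some $\lambda>0$, with norm $\|f\|_{p(\cdot)}=\inf\{\lambda>0:\int_{\mathbb R^n}(|f(x)|/\lambda)^{p(x)}\,dx\le1\}$. An operator $T$ is bounded from $L^{p(\cdot)}$ to $L^{q(\cdot)}$ if there is a finite $C$ such that $Tf\in L^{q(\cdot)}$ and $\|Tf\|_{q(\cdot)}\le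 C\|f\|_{p(\cdot)}$ for all $f\in L^{p(\cdot)}$. Let $\mathscr P$ be the set of measurable $p(\cdot):\mathbb R^n\to[1,\infty)$ with $1<p_-:=\operatorname{ess\,inf}p$ and $p_+:=\operatorname{ess\,sup}p<\infty$, and let $\mathscr B$ be the set of $p(\cdot)\in\mathscr P$ such that $M$ is bounded on $L^{p(\cdot)}$. For $0<\gamma<n$ let $\mathscr B^\gamma$ be the set of pairs $(p(\cdot),q(\cdot))$ with $p(\cdot)\in\mathscr P$, $p_+<n/\gamma$, $1/q(\cdot)=1/p(\cdot)-\gamma/n$ and $q(\cdot)(n-\gamma)/n\in\mathscr B$. Then the following statements are equivalent: 1. $b\in\dot\Lambda_\beta$, that is, $b$ agrees almost everywhere with a function $g$ for which there is $C>0$ with $|g(x)-g(y)|\le C|x-y|^\beta$ for all $x,y\in\mathbb R^n$; 2. $M_{\alpha,b}$ is bounded from $L^{p(\cdot)}$ to $L^{q(\cdot)}$ for some $(p(\cdot),q(\cdot))\in\mathscr B^{\alpha+\beta}$; 3. $M_{\alpha,b}$ is bounded from $L^{p(\cdot)}$ to $L^{q(\cdot)}$ for all $(p(\cdot),q(\cdot))\in\mathscr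 B^{\alpha+\beta}$; 4. there exists $s(\cdot)\in\mathscr B$ such that $$\sup_Q\frac1{|Q|^{\beta/n}}\,\frac{\|(b-b_Q)\chi_Q\|_{s(\cdot)}}{\|\chi_Q\|_{s(\cdot)}}<\infty;\qquad(*)$$ 5. $(*)$ holds for all $s(\cdot)\in\mathscr B$. -/

import Mathlib

open MeasureTheory
open scoped ENNReal NNReal

namespace VarLebesgue

noncomputable section

/-- `ℝⁿ` with the Euclidean norm and Lebesgue measure. -/
abbrev Rn (n : ℕ) : Type := EuclideanSpace ℝ (Fin n)

/-- The closed cube with sides parallel to the coordinate axes, lower corner `a` and side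
length `r` (a genuine cube when `0 < r`). -/
def cube {n : ℕ} (a : Rn n) (r : ℝ) : Set (Rn n) :=
  {x | ∀ i, a i ≤ x i ∧ x i ≤ a i + r}

/-- The modular `∫ |f(x) / t| ^ p(x) dx` of `f` at scale `t`.  The function `f` may be real valued,
or take values in `[0, ∞]` as maximal functions do. -/
def modular {n : ℕ} {F : Type*} [ENorm F] (p : Rn n → ℝ) (f : Rn n → F) (t : ℝ≥0) : ℝ≥0∞ :=
  ∫⁻ x, (‖f x‖ₑ / (t : ℝ≥0∞)) ^ (p x)

/-- `f ∈ L^{p(·)}(ℝⁿ)`: `f` is (Lebesgue) measurable and its modular is finite at some scale. -/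
def MemVarLp {n : ℕ} {F : Type*} [ENorm F] [MeasurableSpace F]
    (p : Rn n → ℝ) (f : Rn n → F) : Prop :=
  AEMeasurable f volume ∧ ∃ t : ℝ≥0, 0 < t ∧ modular p f t < ∞

/-- The Luxemburg norm `inf {t > 0 : ∫ |f(x) / t| ^ p(x) dx ≤ 1}` (it is `∞` if there is no
such `t`). -/
def varNorm {n : ℕ} {F : Type*} [ENorm F] (p : Rn n → ℝ) (f : Rn n → F) : ℝ≥0∞ :=
  ⨅ (t : ℝ≥0) (_ : 0 < t) (_ : modular p f t ≤ 1), (t : ℝ≥0∞)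

/-- A (not necessarily linear) operator `T`, with values in functions to `[0, ∞]`, is bounded from
`L^{p(·)}(ℝⁿ)` to `L^{q(·)}(ℝⁿ)`. -/
def BoundedVar {n : ℕ} (T : (Rn n → ℝ) → Rn n → ℝ≥0∞) (p q : Rn n → ℝ) : Prop :=
  ∃ C : ℝ≥0, ∀ f : Rn n → ℝ, MemVarLp p f →
    MemVarLp q (T f) ∧ varNorm q (T f) ≤ C * varNorm p f

/-- The Hardy-Littlewood maximal function over all cubes containing the point. -/
def maximal {n : ℕ} (f : Rn n → ℝ) (x : Rn n) : ℝ≥0∞ :=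
  ⨆ (a : Rn n) (r : ℝ) (_ : 0 < r) (_ : x ∈ cube a r),
    (∫⁻ y in cube a r, ‖f y‖ₑ) / volume (cube a r)

/-- The maximal commutator
`M_{α,b}(f)(x) = sup_{Q ∋ x} |Q|^{-(1-α/n)} ∫_Q |b(x) - b(y)| |f(y)| dy`. -/
def maximalCommutator {n : ℕ} (α : ℝ) (b : Rn n → ℝ) (f : Rn n → ℝ) (x : Rn n) : ℝ≥0∞ :=
  ⨆ (a : Rn n) (r : ℝ) (_ : 0 < r) (_ : x ∈ cube a r),
    (∫⁻ y in cube a r, ‖b x - b y‖ₑ * ‖f y‖ₑ) / volume (cube a r) ^ (1 - α / (n : ℝ))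

/-- `p₋`, the essential infimum of an exponent. -/
def lowerExp {n : ℕ} (p : Rn n → ℝ) : ℝ≥0∞ := essInf (fun x => ENNReal.ofReal (p x)) volume

/-- `p₊`, the essential supremum of an exponent. -/
def upperExp {n : ℕ} (p : Rn n → ℝ) : ℝ≥0∞ := essSup (fun x => ENNReal.ofReal (p x)) volume

/-- The class `𝓟(ℝⁿ)`: measurable `p(·) : ℝⁿ → [1, ∞)` with `1 < p₋` and `p₊ < ∞`. -/
structure ClassP {n : ℕ} (p : Rn n → ℝ) : Prop where
  measurable : AEMeasurable p volume
  one_le : ∀ x, 1 ≤ p x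
  one_lt_lower : 1 < lowerExp p
  upper_lt_top : upperExp p < ∞

/-- The class `𝓑(ℝⁿ)`: exponents in `𝓟(ℝⁿ)` for which the Hardy-Littlewood maximal operator is
bounded on `L^{p(·)}(ℝⁿ)`. -/
def ClassB {n : ℕ} (p : Rn n → ℝ) : Prop :=
  ClassP p ∧ BoundedVar maximal p p

/-- The class `𝓑^γ(ℝⁿ)` of pairs of exponents (used for `0 < γ < n`). -/
structure ClassBPair {n : ℕ} (γ : ℝ) (p q : Rn n → ℝ) : Prop where
  classP : ClassP p
  upper_lt : upperExp p < ENNReal.ofReal ((n : ℝ) / γ)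
  inv_eq : ∀ x, 1 / q x = 1 / p x - γ / (n : ℝ)
  classB : ClassB (fun x => q x * ((n : ℝ) - γ) / (n : ℝ))

/-- `g` is in the homogeneous Lipschitz space `Λ̇_β(ℝⁿ)`. -/
def IsLip {n : ℕ} (β : ℝ) (g : Rn n → ℝ) : Prop :=
  ∃ C : ℝ, 0 < C ∧ ∀ x y, |g x - g y| ≤ C * ‖x - y‖ ^ β

/-- Membership of a locally integrable function, i.e. of its class modulo almost everywhere
equality, in `Λ̇_β(ℝⁿ)`. -/
def MemLip {n : ℕ} (β : ℝ) (b : Rn n → ℝ) : Prop :=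
  ∃ g : Rn n → ℝ, IsLip β g ∧ b =ᵐ[volume] g

/-- The supremum over all cubes `Q` of
`|Q|^{-β/n} ‖(b - b_Q) χ_Q‖_{s(·)} / ‖χ_Q‖_{s(·)}`. -/
def oscSup {n : ℕ} (β : ℝ) (b : Rn n → ℝ) (s : Rn n → ℝ) : ℝ≥0∞ :=
  ⨆ (a : Rn n) (r : ℝ) (_ : 0 < r),
    1 / volume (cube a r) ^ (β / (n : ℝ)) *
      (varNorm s ((cube a r).indicator (fun x => b x - ⨍ y in cube a r, b y)) /
        varNorm s ((cube a r).indicator (fun _ => (1 : ℝ))))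

end

end VarLebesgue

namespace VarLebesgue

open Set Filter Topology

section Cubes

variable {n : ℕ}

theorem isClosed_cube (a : Rn n) (r : ℝ) : IsClosed (cube a r) := by
  have : cube a r = ⋂ i, ({x : Rn n | a i ≤ x i} ∩ {x | x i ≤ a i + r}) := by
    ext x; simp [cube]
  rw [this]
  refine isClosed_iInter fun i => IsClosed.inter ?_ ?_
  · exact isClosed_le (by fun_prop) (by fun_prop)
  · exact isClosed_le (by fun_prop) (by fun_prop)

theorem measurableSet_cube (a : Rn n) (r : ℝ) : MeasurableSet (cube a r) :=
  (isClosed_cube a r).measurableSet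

theorem volume_cube (a : Rn n) (r : ℝ) : volume (cube a r) = ENNReal.ofReal r ^ n := by
  have h := (PiLp.volume_preserving_toLp (Fin n)).measure_preimage
    (measurableSet_cube a r).nullMeasurableSet
  have h2 : (WithLp.toLp 2) ⁻¹' (cube a r)
      = Set.Icc (fun i => a i) (fun i => a i + r) := by
    ext x; simp [cube, Set.mem_Icc, Pi.le_def, forall_and]
  rw [← h, h2, Real.volume_Icc_pi]
  simp

theorem volume_cube_ne_top (a : Rn n) (r : ℝ) : volume (cube a r) ≠ ∞ := by
  rw [volume_cube]; finiteness

theorem volume_cube_ne_zero (a : Rn n) {r : ℝ} (hr : 0 < r) : volume (cube a r) ≠ 0 := by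
  rw [volume_cube]; exact pow_ne_zero _ (by simpa using hr)

theorem volume_cube_rpow (hn : 0 < n) (a : Rn n) {r : ℝ} (hr : 0 < r) (t : ℝ) :
    volume (cube a r) ^ (t / (n : ℝ)) = ENNReal.ofReal (r ^ t) := by
  have hn' : (n : ℝ) ≠ 0 := by positivity
  rw [volume_cube, ← ENNReal.rpow_natCast, ← ENNReal.rpow_mul,
    mul_div_cancel₀ _ hn', ENNReal.ofReal_rpow_of_pos hr]

theorem norm_sub_le_of_mem_cube {a : Rn n} {r : ℝ} (hr : 0 ≤ r) {x y : Rn n}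
    (hx : x ∈ cube a r) (hy : y ∈ cube a r) : ‖x - y‖ ≤ n * r := by
  rw [EuclideanSpace.norm_eq]
  have h1 : ∀ i, ‖(x - y) i‖ ^ 2 ≤ r ^ 2 := fun i => by
    have := hx i; have := hy i
    rw [Real.norm_eq_abs]
    refine pow_le_pow_left₀ (abs_nonneg _) ?_ 2
    rw [abs_le]; constructor <;> simp <;> linarith
  refine Real.sqrt_le_iff.2 ⟨by positivity, (Finset.sum_le_sum fun i _ => h1 i).trans ?_⟩
  rw [Finset.sum_const, Finset.card_univ, Fintype.card_fin, nsmul_eq_mul, mul_pow]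
  gcongr
  exact_mod_cast Nat.le_self_pow two_ne_zero n

theorem closedBall_subset_cube (x : Rn n) (ρ : ℝ) :
    Metric.closedBall x ρ ⊆ cube (WithLp.toLp 2 fun i => x i - ρ) (2 * ρ) := by
  intro y hy i
  have h := (PiLp.norm_apply_le (y - x) i).trans (mem_closedBall_iff_norm.1 hy)
  rw [Real.norm_eq_abs, abs_le] at h
  simp at h ⊢
  constructor <;> linarith

theorem integrableOn_cube {b : Rn n → ℝ} (hb : LocallyIntegrable b volume) (a : Rn n) (r : ℝ) :
    IntegrableOn b (cube a r) volume := by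
  rcases lt_or_ge r 0 with hr | hr
  · rcases Nat.eq_zero_or_pos n with rfl | hn
    · exact hb.integrableOn_isCompact (isClosed_cube a r).isCompact
    · have : cube a r = ∅ := by
        ext x; simp only [mem_empty_iff_false, iff_false]
        intro hx; have := hx ⟨0, hn⟩; linarith
      simp [this]
  · refine hb.integrableOn_isCompact (Metric.isCompact_of_isClosed_isBounded (isClosed_cube a r) ?_)
    exact Metric.isBounded_iff.2 ⟨n * r, fun x hx y hy => by
      rw [dist_eq_norm]; exact norm_sub_le_of_mem_cube hr hx hy⟩

/-- The concentric cube with sides longer by `2 * ε` is a neighbourhood of each point of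
`cube a r`. -/
theorem cube_mem_nhds_of_mem {a x : Rn n} {r ε : ℝ} (hε : 0 < ε) (hx : x ∈ cube a r) :
    cube (WithLp.toLp 2 fun i => a i - ε) (r + 2 * ε) ∈ 𝓝 x := by
  refine mem_of_superset (Metric.closedBall_mem_nhds x hε) fun y hy i => ?_
  have h := (PiLp.norm_apply_le (y - x) i).trans (mem_closedBall_iff_norm.1 hy)
  rw [Real.norm_eq_abs, abs_le] at h
  have := hx i
  simp at h ⊢
  constructor <;> linarith

theorem cube_subset_enlarge (a : Rn n) (r : ℝ) {ε : ℝ} (hε : 0 ≤ ε) :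
    cube a r ⊆ cube (WithLp.toLp 2 fun i => a i - ε) (r + 2 * ε) := by
  intro x hx i
  have := hx i
  simp only
  constructor <;> linarith

theorem cube_subset_of_inter {a c : Rn n} {r s : ℝ} (hrs : r ≤ 2 * s)
    (h : (cube a r ∩ cube c s).Nonempty) :
    cube a r ⊆ cube (WithLp.toLp 2 fun i => c i - 2 * s) (5 * s) := by
  obtain ⟨z, hz1, hz2⟩ := h
  intro x hx i
  have := hx i; have := hz1 i; have := hz2 i
  simp only
  constructor <;> linarith

end Cubes

section Norm

variable {n : ℕ} {F G : Type*} [ENorm F] [ENorm G]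

theorem varNorm_le_of_modular_le {p : Rn n → ℝ} {f : Rn n → F} {t : ℝ≥0} (ht : 0 < t)
    (h : modular p f t ≤ 1) : varNorm p f ≤ t :=
  iInf_le_of_le t (iInf_le_of_le ht (iInf_le _ h))

theorem exists_modular_le_of_varNorm_lt {p : Rn n → ℝ} {f : Rn n → F} {c : ℝ≥0∞}
    (h : varNorm p f < c) : ∃ t : ℝ≥0, 0 < t ∧ modular p f t ≤ 1 ∧ (t : ℝ≥0∞) < c := by
  simp only [varNorm, iInf_lt_iff] at h
  obtain ⟨t, h1, h2, h3⟩ := h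
  exact ⟨t, h1, h2, h3⟩

theorem le_varNorm {p : Rn n → ℝ} {f : Rn n → F} {c : ℝ≥0∞}
    (h : ∀ t : ℝ≥0, 0 < t → modular p f t ≤ 1 → c ≤ t) : c ≤ varNorm p f :=
  le_iInf fun t => le_iInf fun ht => le_iInf fun hm => h t ht hm

theorem varNorm_le_mul {p q : Rn n → ℝ} {f : Rn n → F} {g : Rn n → G} {C : ℝ≥0} (hC : 0 < C)
    (h : ∀ t : ℝ≥0, 0 < t → modular q g t ≤ 1 → modular p f (C * t) ≤ 1) :
    varNorm p f ≤ C * varNorm q g := by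
  rw [mul_comm, ← ENNReal.div_le_iff_le_mul (.inl (by simp [hC.ne'])) (.inl (by simp))]
  refine le_varNorm fun t ht hm => ?_
  rw [ENNReal.div_le_iff_le_mul (.inl (by simp [hC.ne'])) (.inl (by simp)), mul_comm]
  exact_mod_cast varNorm_le_of_modular_le (mul_pos hC ht) (h t ht hm)

theorem modular_mono {p : Rn n → ℝ} (hp : ∀ x, 0 ≤ p x) {f : Rn n → F} {g : Rn n → G} {s t : ℝ≥0}
    (h : ∀ᵐ x, ‖f x‖ₑ / (s : ℝ≥0∞) ≤ ‖g x‖ₑ / (t : ℝ≥0∞)) : modular p f s ≤ modular p g t :=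
  lintegral_mono_ae (h.mono fun x hx => ENNReal.rpow_le_rpow hx (hp x))

theorem varNorm_le_mul_of_ae_le {p : Rn n → ℝ} (hp : ∀ x, 0 ≤ p x) {f : Rn n → F} {g : Rn n → G}
    {C : ℝ≥0} (hC : 0 < C) (h : ∀ᵐ x, ‖f x‖ₑ ≤ C * ‖g x‖ₑ) :
    varNorm p f ≤ C * varNorm p g := by
  refine varNorm_le_mul hC fun t ht hm => (modular_mono hp ?_).trans hm
  filter_upwards [h] with x hx
  rw [ENNReal.coe_mul, ← ENNReal.mul_div_mul_left (‖g x‖ₑ) (t : ℝ≥0∞) (c := C)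
    (by simp [hC.ne']) (by simp)]
  gcongr

theorem mul_varNorm_le_of_ae_le {p : Rn n → ℝ} (hp : ∀ x, 0 ≤ p x) {f : Rn n → F} {g : Rn n → G}
    (C : ℝ≥0) (h : ∀ᵐ x, C * ‖f x‖ₑ ≤ ‖g x‖ₑ) :
    C * varNorm p f ≤ varNorm p g := by
  rcases eq_zero_or_pos C with rfl | hC
  · simp
  have h0 : (C : ℝ≥0∞) ≠ 0 := by simp [hC.ne']
  have := varNorm_le_mul_of_ae_le hp (f := f) (g := g) (inv_pos.2 hC) (h.mono fun x hx => by
    rw [ENNReal.coe_inv hC.ne', ← ENNReal.div_eq_inv_mul]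
    rwa [ENNReal.le_div_iff_mul_le (.inl h0) (by simp), mul_comm])
  rwa [ENNReal.coe_inv hC.ne', ← ENNReal.div_eq_inv_mul,
    ENNReal.le_div_iff_mul_le (.inl h0) (by simp), mul_comm] at this

theorem modular_mul_le {p : Rn n → ℝ} (hp : ∀ x, 1 ≤ p x) (f : Rn n → F) {c : ℝ≥0} (hc : 1 ≤ c)
    (t : ℝ≥0) : modular p f (c * t) ≤ modular p f t / c := by
  have hc0 : c ≠ 0 := (one_pos.trans_le hc).ne'
  rw [div_eq_mul_inv, mul_comm (modular p f t), modular, modular,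
    ← lintegral_const_mul' _ _ (by simp [hc0])]
  refine lintegral_mono fun x => ?_
  have h0 : (‖f x‖ₑ / ((c * t : ℝ≥0) : ℝ≥0∞)) = (c : ℝ≥0∞)⁻¹ * (‖f x‖ₑ / t) := by
    rw [ENNReal.coe_mul, div_eq_mul_inv, div_eq_mul_inv,
      ENNReal.mul_inv (.inl (by simp [hc0])) (.inl (by simp))]
    ring
  rw [h0, ENNReal.mul_rpow_of_nonneg _ _ (zero_le_one.trans (hp x))]
  gcongr
  have : (c : ℝ≥0∞)⁻¹ ≤ 1 := by simpa using hc
  simpa using ENNReal.rpow_le_rpow_of_exponent_ge this (hp x)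

theorem exists_modular_le_one {p : Rn n → ℝ} (hp : ∀ x, 1 ≤ p x) {f : Rn n → F} {t : ℝ≥0}
    (ht : 0 < t) (h : modular p f t < ∞) : ∃ s : ℝ≥0, 0 < s ∧ modular p f s ≤ 1 := by
  lift modular p f t to ℝ≥0 using h.ne with m hm
  have h1 : 1 ≤ max 1 m := le_max_left _ _
  refine ⟨max 1 m * t, mul_pos (one_pos.trans_le h1) ht, (modular_mul_le hp f h1 t).trans ?_⟩
  rw [← hm]
  exact ENNReal.div_le_of_le_mul (by simp)

theorem boundedVar_of_modular {p q : Rn n → ℝ} (hp : ∀ x, 1 ≤ p x)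
    {T : (Rn n → ℝ) → Rn n → ℝ≥0∞} {C : ℝ≥0} (hC : 0 < C)
    (h : ∀ f : Rn n → ℝ, AEMeasurable f volume →
      ∀ t : ℝ≥0, 0 < t → modular p f t ≤ 1 → AEMeasurable (T f) ∧ modular q (T f) (C * t) ≤ 1) :
    BoundedVar T p q := by
  refine ⟨C, fun f ⟨hf, t, ht, hm⟩ => ⟨?_, varNorm_le_mul hC fun s hs hms => (h f hf s hs hms).2⟩⟩
  obtain ⟨s, hs, hms⟩ := exists_modular_le_one hp ht hm
  obtain ⟨h1, h2⟩ := h f hf s hs hms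
  exact ⟨h1, C * s, mul_pos hC hs, h2.trans_lt ENNReal.one_lt_top⟩

theorem memVarLp_of_varNorm_lt_top [MeasurableSpace F] {p : Rn n → ℝ} {f : Rn n → F}
    (hf : AEMeasurable f volume) (h : varNorm p f < ∞) : MemVarLp p f := by
  obtain ⟨t, ht, hm, -⟩ := exists_modular_le_of_varNorm_lt h
  exact ⟨hf, t, ht, hm.trans_lt ENNReal.one_lt_top⟩

theorem modular_indicator_one {p : Rn n → ℝ} (hp : ∀ x, 0 < p x) {s : Set (Rn n)}
    (hs : MeasurableSet s) (t : ℝ≥0) :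
    modular p (s.indicator fun _ => (1 : ℝ)) t = ∫⁻ x in s, (t : ℝ≥0∞)⁻¹ ^ p x := by
  rw [← lintegral_indicator hs, modular]
  congr 1; ext x
  by_cases hx : x ∈ s <;> simp [hx, hp x]

theorem varNorm_indicator_one_ne_top {p : Rn n → ℝ} (hp : ∀ x, 1 ≤ p x) {s : Set (Rn n)}
    (hs : MeasurableSet s) (hv : volume s ≠ ∞) :
    varNorm p (s.indicator fun _ => (1 : ℝ)) ≠ ∞ := by
  have h : modular p (s.indicator fun _ => (1 : ℝ)) 1 < ∞ := by
    rw [modular_indicator_one (fun x => one_pos.trans_le (hp x)) hs]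
    simpa using hv.lt_top
  obtain ⟨t, ht, hm⟩ := exists_modular_le_one hp one_pos h
  exact ((varNorm_le_of_modular_le ht hm).trans_lt ENNReal.coe_lt_top).ne

theorem varNorm_indicator_one_ne_zero {p : Rn n → ℝ} (hp : ∀ x, 1 ≤ p x) {s : Set (Rn n)}
    (hs : MeasurableSet s) (hv : volume s ≠ 0) :
    varNorm p (s.indicator fun _ => (1 : ℝ)) ≠ 0 := by
  have h : min 1 (volume s) ≤ varNorm p (s.indicator fun _ => (1 : ℝ)) := by
    refine le_varNorm fun t ht hm => ?_
    rcases le_or_gt 1 t with h1 | h1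
    · exact (min_le_left _ _).trans (by exact_mod_cast h1)
    refine (min_le_right _ _).trans ?_
    rw [modular_indicator_one (fun x => one_pos.trans_le (hp x)) hs] at hm
    have h2 : volume s * (t : ℝ≥0∞)⁻¹ ≤ 1 := by
      refine le_trans ?_ hm
      rw [mul_comm, ← setLIntegral_const]
      refine lintegral_mono fun x => ?_
      have : 1 ≤ (t : ℝ≥0∞)⁻¹ := by simpa using h1.le
      simpa using ENNReal.rpow_le_rpow_of_exponent_le this (hp x)
    rw [← div_eq_mul_inv, ENNReal.div_le_iff (by simp [ht.ne']) (by simp)] at h2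
    simpa using h2
  intro h0
  rw [h0] at h
  simp [hv] at h

end Norm

section Maximal

variable {n : ℕ}

theorem lowerSemicontinuous_iSup_cube {K : Rn n → Rn n → ℝ≥0∞} {θ : ℝ} (hθ : 0 ≤ θ)
    (hK : ∀ x, AEMeasurable (K x) volume) (hc : ∀ y, LowerSemicontinuous fun x => K x y) :
    LowerSemicontinuous fun x => ⨆ (a : Rn n) (r : ℝ) (_ : 0 < r) (_ : x ∈ cube a r),
      (∫⁻ y in cube a r, K x y) / volume (cube a r) ^ θ := by
  have hJ : ∀ a r, LowerSemicontinuous fun x => ∫⁻ y in cube a r, K x y := fun a r x => by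
    refine lowerSemicontinuousAt_iff_le_liminf.2 ?_
    refine le_trans (lintegral_mono fun y => ?_) (lintegral_liminf_le' fun x => (hK x).restrict)
    exact lowerSemicontinuousAt_iff_le_liminf.1 (hc y x)
  intro x c hx
  simp only [lt_iSup_iff] at hx ⊢
  obtain ⟨a, r, hr, hxa, hlt⟩ := hx
  have hlim : Tendsto (fun ε : ℝ => (∫⁻ y in cube a r, K x y) / (ENNReal.ofReal (r + 2 * ε) ^ n) ^ θ)
      (𝓝[>] 0) (𝓝 ((∫⁻ y in cube a r, K x y) / volume (cube a r) ^ θ)) := by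
    rw [volume_cube]
    refine (ENNReal.Tendsto.const_div ?_ (.inl ?_)).mono_left nhdsWithin_le_nhds
    · have : Continuous fun ε : ℝ => (ENNReal.ofReal (r + 2 * ε) ^ n) ^ θ :=
        ENNReal.continuous_rpow_const.comp ((ENNReal.continuous_pow n).comp
          (ENNReal.continuous_ofReal.comp (by fun_prop)))
      simpa using this.tendsto 0
    · finiteness
  obtain ⟨ε, hε, hε0⟩ := ((hlim.eventually (lt_mem_nhds hlt)).and self_mem_nhdsWithin).exists
  have hε0 : 0 < ε := hε0
  have hr' : 0 < r + 2 * ε := by positivity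
  rw [← volume_cube (WithLp.toLp 2 fun i => a i - ε) (r + 2 * ε)] at hε
  have hV : (volume (cube (WithLp.toLp 2 fun i => a i - ε) (r + 2 * ε)) : ℝ≥0∞) ^ θ ≠ 0 := by
    simp [volume_cube_ne_zero _ hr', volume_cube_ne_top]
  have hV' : (volume (cube (WithLp.toLp 2 fun i => a i - ε) (r + 2 * ε)) : ℝ≥0∞) ^ θ ≠ ∞ :=
    ENNReal.rpow_ne_top_of_nonneg hθ (volume_cube_ne_top _ _)
  have h2 := (ENNReal.lt_div_iff_mul_lt (.inl hV) (.inl hV')).1 (hε.trans_le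
    (ENNReal.div_le_div_right (lintegral_mono_set (cube_subset_enlarge a r hε0.le)) _))
  filter_upwards [hJ _ _ x _ h2, cube_mem_nhds_of_mem hε0 hxa] with z hz hza
  exact ⟨_, _, hr', hza, (ENNReal.lt_div_iff_mul_lt (.inl hV) (.inl hV')).2 hz⟩

theorem measurable_maximal {f : Rn n → ℝ} (hf : AEMeasurable f volume) :
    Measurable (maximal f) := by
  have := (lowerSemicontinuous_iSup_cube (n := n) (K := fun _ y => ‖f y‖ₑ) zero_le_one
    (fun _ => hf.enorm) fun y => lowerSemicontinuous_const).measurable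
  simp only [ENNReal.rpow_one] at this
  exact this

theorem maximal_congr_ae {f g : Rn n → ℝ} (h : f =ᵐ[volume] g) : maximal f = maximal g := by
  ext x
  simp only [maximal]
  congr! 7 with a r _ _
  exact lintegral_congr_ae (ae_restrict_of_ae (h.mono fun y hy => by simp [hy]))

theorem le_maximal (f : Rn n → ℝ) {a x : Rn n} {r : ℝ} (hr : 0 < r) (hx : x ∈ cube a r) :
    (∫⁻ y in cube a r, ‖f y‖ₑ) / volume (cube a r) ≤ maximal f x :=
  le_iSup_of_le a (le_iSup_of_le r (le_iSup_of_le hr (le_iSup_of_le hx le_rfl)))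

/-- The weak type `(1, 1)` inequality for the maximal operator. -/
theorem mul_volume_lt_maximal_le (hn : 0 < n) (f : Rn n → ℝ) {l : ℝ≥0} (hl : 0 < l) :
    l * volume {x | (l : ℝ≥0∞) < maximal f x} ≤ 5 ^ n * ∫⁻ y, ‖f y‖ₑ := by
  by_cases hI : ∫⁻ y, ‖f y‖ₑ = ∞
  · rw [hI, ENNReal.mul_top (by positivity)]; exact le_top
  have hex : ∀ x : {x | (l : ℝ≥0∞) < maximal f x}, ∃ (a : Rn n) (r : ℝ), 0 < r ∧
      x.1 ∈ cube a r ∧ l * volume (cube a r) ≤ ∫⁻ y in cube a r, ‖f y‖ₑ := by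
    rintro ⟨x, hx⟩
    simp only [maximal, mem_ofPred_eq, lt_iSup_iff] at hx
    obtain ⟨a, r, hr, hxa, h⟩ := hx
    refine ⟨a, r, hr, hxa, ?_⟩
    exact ((ENNReal.lt_div_iff_mul_lt (.inl (volume_cube_ne_zero a hr))
      (.inl (volume_cube_ne_top a r))).1 h).le
  choose a r hr hxa hl' using hex
  have hR : ∀ x, r x ≤ max 1 ((∫⁻ y, ‖f y‖ₑ) / l).toReal := by
    intro x
    rcases le_total (r x) 1 with h1 | h1
    · exact h1.trans (le_max_left _ _)
    refine le_trans ?_ (le_max_right _ _)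
    rw [← ENNReal.ofReal_le_iff_le_toReal (ENNReal.div_ne_top hI (by simp [hl.ne'])),
      ENNReal.le_div_iff_mul_le (.inl (by simp [hl.ne'])) (.inl (by simp)), mul_comm]
    refine le_trans ?_ ((hl' x).trans (setLIntegral_le_lintegral _ _))
    rw [volume_cube]
    gcongr
    exact le_self_pow₀ (by simpa using h1) hn.ne'
  obtain ⟨u, -, hdisj, hcov⟩ := Vitali.exists_disjoint_subfamily_covering_enlargement
    (fun x => cube (a x) (r x)) univ r 2 one_lt_two (fun x _ => (hr x).le) _ (fun x _ => hR x)
    (fun x _ => ⟨x, hxa x⟩)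
  have hdisj' : Pairwise (Function.onFun Disjoint fun x : u => cube (a x) (r x)) :=
    fun x y hxy => hdisj x.2 y.2 (Subtype.coe_ne_coe.2 hxy)
  have hu : Countable u := by
    have := Measure.countable_meas_pos_of_disjoint_iUnion (μ := volume)
      (As := fun x : u => cube (a x) (r x)) (fun x => measurableSet_cube _ _) hdisj'
    have huniv : {i : u | 0 < volume (cube (a i) (r i))} = univ :=
      eq_univ_of_forall fun i => pos_iff_ne_zero.2 (volume_cube_ne_zero _ (hr i))
    rw [huniv] at this
    exact countable_univ_iff.1 this
  have hsub : {x | (l : ℝ≥0∞) < maximal f x} ⊆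
      ⋃ x : u, cube (WithLp.toLp 2 fun i => a x i - 2 * r x) (5 * r x) := by
    intro x hx
    obtain ⟨y, hy, hxy, hle⟩ := hcov ⟨x, hx⟩ (mem_univ _)
    exact mem_iUnion.2 ⟨⟨y, hy⟩, cube_subset_of_inter hle hxy (hxa ⟨x, hx⟩)⟩
  calc l * volume {x | (l : ℝ≥0∞) < maximal f x}
      ≤ l * ∑' x : u, volume (cube (WithLp.toLp 2 fun i => a x i - 2 * r x) (5 * r x)) := by
        gcongr
        exact (measure_mono hsub).trans (measure_iUnion_le _)
    _ = 5 ^ n * ∑' x : u, l * volume (cube (a x) (r x)) := by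
        rw [← ENNReal.tsum_mul_left, ← ENNReal.tsum_mul_left]
        congr 1; ext x
        rw [volume_cube, volume_cube, ENNReal.ofReal_mul (by norm_num), mul_pow]
        simp only [ENNReal.ofReal_ofNat]
        ring
    _ ≤ 5 ^ n * ∑' x : u, ∫⁻ y in cube (a x) (r x), ‖f y‖ₑ := by
        gcongr with x; exact hl' x
    _ = 5 ^ n * ∫⁻ y in ⋃ x : u, cube (a x) (r x), ‖f y‖ₑ := by
        rw [lintegral_iUnion (fun x => measurableSet_cube _ _) hdisj']
    _ ≤ 5 ^ n * ∫⁻ y, ‖f y‖ₑ := by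
        gcongr 5 ^ n * ?_; exact setLIntegral_le_lintegral _ _

theorem mul_volume_lt_maximal_le_truncated (hn : 0 < n) (f : Rn n → ℝ)
    {t : ℝ≥0} (ht : 0 < t) :
    t * volume {x | (t : ℝ≥0∞) < maximal f x} ≤
      2 * 5 ^ n * ∫⁻ y, {y | (t : ℝ≥0∞) < 2 * ‖f y‖ₑ}.indicator (fun y => ‖f y‖ₑ) y := by
  set S := {y | (t : ℝ≥0∞) < 2 * ‖f y‖ₑ} with hS
  have ht2 : 0 < t / 2 := by positivity
  have hsub : {x | (t : ℝ≥0∞) < maximal f x} ⊆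
      {x | ((t / 2 : ℝ≥0) : ℝ≥0∞) < maximal (S.indicator f) x} := by
    intro x hx
    simp only [maximal, mem_ofPred_eq, lt_iSup_iff] at hx
    obtain ⟨a, r, hr, hxa, h⟩ := hx
    refine lt_of_lt_of_le ?_ (le_maximal _ hr hxa)
    have h0 := volume_cube_ne_zero a hr
    have h1 := volume_cube_ne_top a r
    rw [ENNReal.lt_div_iff_mul_lt (.inl h0) (.inl h1)] at h ⊢
    have h3 : ∫⁻ y in cube a r, ‖f y‖ₑ ≤
        (∫⁻ y in cube a r, ‖S.indicator f y‖ₑ) + (t / 2 : ℝ≥0) * volume (cube a r) := by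
      rw [← setLIntegral_const, ← lintegral_add_right _ measurable_const]
      refine lintegral_mono fun y => ?_
      by_cases hy : y ∈ S
      · simp [hy]
      · simp only [hy, not_false_eq_true, indicator_of_notMem, enorm_zero, zero_add]
        have : 2 * ‖f y‖ₑ ≤ t := not_lt.1 hy
        rw [ENNReal.coe_div two_ne_zero, ENNReal.le_div_iff_mul_le (by simp) (by simp), mul_comm]
        exact_mod_cast this
    have h4 : (t : ℝ≥0∞) * volume (cube a r) = (t / 2 : ℝ≥0) * volume (cube a r)
        + (t / 2 : ℝ≥0) * volume (cube a r) := by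
      rw [← add_mul, ← ENNReal.coe_add, add_halves]
    rw [h4] at h
    exact lt_of_add_lt_add_right (h.trans_le h3)
  have hw := mul_volume_lt_maximal_le hn (S.indicator f) ht2
  calc t * volume {x | (t : ℝ≥0∞) < maximal f x}
      ≤ t * volume {x | ((t / 2 : ℝ≥0) : ℝ≥0∞) < maximal (S.indicator f) x} := by gcongr
    _ = 2 * ((t / 2 : ℝ≥0) * volume {x | ((t / 2 : ℝ≥0) : ℝ≥0∞) < maximal (S.indicator f) x}) := by
        rw [← mul_assoc]
        congr 1
        rw [ENNReal.coe_div two_ne_zero]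
        exact (ENNReal.mul_div_cancel (by simp) (by simp)).symm
    _ ≤ 2 * (5 ^ n * ∫⁻ y, ‖S.indicator f y‖ₑ) := by gcongr
    _ = _ := by
        rw [mul_assoc]
        simp only [enorm_indicator_eq_indicator_enorm]

theorem sq_le_two_mul_lintegral (c : ℝ≥0∞) :
    c ^ 2 ≤ 2 * ∫⁻ t in Ioi (0 : ℝ), if ENNReal.ofReal t < c then ENNReal.ofReal t else 0 := by
  have key : ∀ R : ℝ≥0, (R : ℝ≥0∞) < c → (R : ℝ≥0∞) ^ 2 ≤
      2 * ∫⁻ t in Ioi (0 : ℝ), if ENNReal.ofReal t < c then ENNReal.ofReal t else 0 := by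
    intro R hR
    have h1 : ∫⁻ t in Ioc (0 : ℝ) R, ENNReal.ofReal t = ENNReal.ofReal ((R : ℝ) ^ 2 / 2) := by
      rw [← ofReal_integral_eq_lintegral_ofReal (f := fun t : ℝ => t), ← intervalIntegral.integral_of_le R.coe_nonneg]
      · rw [integral_id]; simp
      · exact (continuous_id.integrableOn_Icc (a := (0 : ℝ)) (b := R)).mono_set Ioc_subset_Icc_self
      · exact (ae_restrict_mem measurableSet_Ioc).mono fun t ht => ht.1.le
    have h2 : (R : ℝ≥0∞) ^ 2 = 2 * ∫⁻ t in Ioc (0 : ℝ) R, ENNReal.ofReal t := by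
      rw [h1, ← ENNReal.ofReal_ofNat 2, ← ENNReal.ofReal_mul (by norm_num),
        mul_div_cancel₀ _ two_ne_zero, ENNReal.ofReal_pow R.coe_nonneg, ENNReal.ofReal_coe_nnreal]
    rw [h2]
    gcongr 2 * ?_
    refine le_trans (setLIntegral_mono' measurableSet_Ioc fun t ht => ?_)
      (lintegral_mono_set (Ioc_subset_Ioi_self : Ioc (0 : ℝ) R ⊆ Ioi 0))
    rw [if_pos]
    refine lt_of_le_of_lt ?_ hR
    rw [← ENNReal.ofReal_coe_nnreal]
    exact ENNReal.ofReal_le_ofReal ht.2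
  have hcont : Tendsto (fun x : ℝ≥0∞ => x ^ 2) (𝓝[<] c) (𝓝 (c ^ 2)) :=
    ((ENNReal.continuous_pow 2).tendsto c).mono_left nhdsWithin_le_nhds
  rcases eq_or_ne c 0 with rfl | hc
  · simp
  have : (𝓝[<] c).NeBot := nhdsLT_neBot_of_exists_lt ⟨0, pos_iff_ne_zero.2 hc⟩
  refine le_of_tendsto hcont ?_
  filter_upwards [self_mem_nhdsWithin] with x hx
  lift x to ℝ≥0 using (lt_of_lt_of_le hx le_top).ne
  exact key x hx

theorem lintegral_maximal_sq_le_of_measurable (hn : 0 < n) {f : Rn n → ℝ} (hf : Measurable f) :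
    ∫⁻ x, maximal f x ^ 2 ≤ 8 * 5 ^ n * ∫⁻ x, ‖f x‖ₑ ^ 2 := by
  have hm := measurable_maximal hf.aemeasurable
  have hfe : Measurable fun x => ‖f x‖ₑ := hf.enorm
  have e1 : ∀ t : ℝ, ∫⁻ x, (if ENNReal.ofReal t < maximal f x then ENNReal.ofReal t else 0)
      = ENNReal.ofReal t * volume {x | ENNReal.ofReal t < maximal f x} := by
    intro t
    rw [← lintegral_indicator_const (measurableSet_lt measurable_const hm)]
    simp only [indicator, mem_ofPred_eq]
  have e2 : ∀ x, ∫⁻ t in Ioi (0 : ℝ),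
      {y | ENNReal.ofReal t < 2 * ‖f y‖ₑ}.indicator (fun y => ‖f y‖ₑ) x ≤ 2 * ‖f x‖ₑ ^ 2 := by
    intro x
    calc _ = ∫⁻ t in Ioi (0 : ℝ), {t : ℝ | ENNReal.ofReal t < 2 * ‖f x‖ₑ}.indicator
            (fun _ => ‖f x‖ₑ) t := rfl
      _ ≤ ∫⁻ t : ℝ, (Ioo 0 (2 * |f x|)).indicator (fun _ => ‖f x‖ₑ) t := by
          rw [← lintegral_indicator measurableSet_Ioi]
          refine lintegral_mono fun t => ?_
          rw [indicator_indicator]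
          refine indicator_le_indicator_of_subset ?_ (by simp) t
          rintro s ⟨hs, hs'⟩
          refine ⟨hs, ?_⟩
          simp only [mem_ofPred_eq, Real.enorm_eq_ofReal_abs] at hs'
          rw [← ENNReal.ofReal_ofNat 2, ← ENNReal.ofReal_mul (by norm_num)] at hs'
          exact (ENNReal.ofReal_lt_ofReal_iff_of_nonneg (mem_Ioi.1 hs).le).1 hs'
      _ = 2 * ‖f x‖ₑ ^ 2 := by
          rw [lintegral_indicator_const measurableSet_Ioo, Real.volume_Ioo, sub_zero,
            ENNReal.ofReal_mul (by norm_num), Real.enorm_eq_ofReal_abs]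
          simp only [ENNReal.ofReal_ofNat]
          ring
  calc ∫⁻ x, maximal f x ^ 2
      ≤ ∫⁻ x, 2 * ∫⁻ t in Ioi (0 : ℝ),
          if ENNReal.ofReal t < maximal f x then ENNReal.ofReal t else 0 :=
        lintegral_mono fun x => sq_le_two_mul_lintegral _
    _ = 2 * ∫⁻ t in Ioi (0 : ℝ), ENNReal.ofReal t * volume {x | ENNReal.ofReal t < maximal f x} := by
        rw [lintegral_const_mul' _ _ (by simp), lintegral_lintegral_swap]
        · simp only [e1]
        · refine Measurable.aemeasurable (Measurable.ite ?_ (by fun_prop) measurable_const)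
          exact measurableSet_lt (by fun_prop) (hm.comp measurable_fst)
    _ ≤ 2 * ∫⁻ t in Ioi (0 : ℝ), 2 * 5 ^ n *
          ∫⁻ x, {y | ENNReal.ofReal t < 2 * ‖f y‖ₑ}.indicator (fun y => ‖f y‖ₑ) x := by
        gcongr 2 * ?_
        refine setLIntegral_mono' measurableSet_Ioi fun t ht => ?_
        exact mul_volume_lt_maximal_le_truncated hn f (Real.toNNReal_pos.2 ht)
    _ = 2 * (2 * 5 ^ n * ∫⁻ x, ∫⁻ t in Ioi (0 : ℝ),
          {y | ENNReal.ofReal t < 2 * ‖f y‖ₑ}.indicator (fun y => ‖f y‖ₑ) x) := by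
        rw [lintegral_const_mul' _ _ (by finiteness), lintegral_lintegral_swap]
        refine Measurable.aemeasurable ?_
        have : MeasurableSet {z : ℝ × Rn n | ENNReal.ofReal z.1 < 2 * ‖f z.2‖ₑ} :=
          measurableSet_lt (by fun_prop) (by fun_prop)
        exact (hfe.comp measurable_snd).indicator this
    _ ≤ 2 * (2 * 5 ^ n * ∫⁻ x, 2 * ‖f x‖ₑ ^ 2) := by
        gcongr with x; exact e2 x
    _ = 8 * 5 ^ n * ∫⁻ x, ‖f x‖ₑ ^ 2 := by
        rw [lintegral_const_mul' _ _ (by simp)]; ring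

theorem lintegral_maximal_sq_le (hn : 0 < n) {f : Rn n → ℝ} (hf : AEMeasurable f volume) :
    ∫⁻ x, maximal f x ^ 2 ≤ 8 * 5 ^ n * ∫⁻ x, ‖f x‖ₑ ^ 2 := by
  rw [maximal_congr_ae hf.ae_eq_mk]
  refine (lintegral_maximal_sq_le_of_measurable hn hf.measurable_mk).trans_eq ?_
  congr 1
  exact lintegral_congr_ae (hf.ae_eq_mk.symm.mono fun x hx => by simp only [hx])

theorem classP_const {c : ℝ} (hc : 1 < c) : ClassP (fun _ : Rn n => c) where
  measurable := aemeasurable_const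
  one_le _ := hc.le
  one_lt_lower := by
    rw [lowerExp, essInf_const _ (NeZero.ne _)]
    simpa using hc
  upper_lt_top := by
    rw [upperExp, essSup_const _ (NeZero.ne _)]
    simp

theorem classB_two (hn : 0 < n) : ClassB (fun _ : Rn n => (2 : ℝ)) := by
  refine ⟨classP_const one_lt_two, ?_⟩
  refine boundedVar_of_modular (C := 8 * 5 ^ n) (fun _ => one_le_two) (by positivity)
    fun f hf t ht hm => ⟨(measurable_maximal hf).aemeasurable, ?_⟩
  have hmod : ∀ (F : Type) [ENorm F] (g : Rn n → F) (s : ℝ≥0), 0 < s →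
      modular (fun _ => 2) g s = (∫⁻ x, ‖g x‖ₑ ^ 2) / (s : ℝ≥0∞) ^ 2 := by
    intro F _ g s hs
    rw [modular, div_eq_mul_inv, mul_comm, ← lintegral_const_mul' _ _ (by simp [hs.ne'])]
    congr 1; ext x
    rw [show (2 : ℝ) = ((2 : ℕ) : ℝ) by norm_num, ENNReal.rpow_natCast, div_eq_mul_inv, mul_pow,
      ENNReal.inv_pow, mul_comm]
  have ht0 : (t : ℝ≥0∞) ≠ 0 := by simp [ht.ne']
  rw [hmod _ _ _ ht] at hm
  rw [hmod _ _ _ (by positivity)]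
  refine ENNReal.div_le_of_le_mul ?_
  rw [ENNReal.div_le_iff (by simp [ht.ne']) (by simp)] at hm
  simp only [enorm_eq_self]
  refine (lintegral_maximal_sq_le hn hf).trans ?_
  have h1 : (1 : ℝ≥0∞) ≤ 8 * 5 ^ n := by
    exact_mod_cast Nat.one_le_iff_ne_zero.2 (by positivity)
  calc (8 * 5 ^ n : ℝ≥0∞) * ∫⁻ x, ‖f x‖ₑ ^ 2 ≤ (8 * 5 ^ n) * (1 * (t : ℝ≥0∞) ^ 2) := by gcongr
    _ = (8 * 5 ^ n) * 1 * (t : ℝ≥0∞) ^ 2 := by ring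
    _ ≤ (8 * 5 ^ n) * (8 * 5 ^ n) * (t : ℝ≥0∞) ^ 2 := by gcongr
    _ = 1 * ((8 * 5 ^ n * t : ℝ≥0) : ℝ≥0∞) ^ 2 := by push_cast; ring

end Maximal

section Campanato

variable {n : ℕ} {b : Rn n → ℝ} {β : ℝ}

theorem abs_setAverage_sub_le {A Q : Set (Rn n)} (hAQ : A ⊆ Q)
    (hA : volume A ≠ 0) (hQt : volume Q ≠ ∞) (hb : IntegrableOn b Q volume) (c : ℝ) :
    |(⨍ y in A, b y) - c| ≤ (∫ y in Q, |b y - c|) / volume.real A := by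
  have hAt : volume A ≠ ∞ := ((measure_mono hAQ).trans_lt hQt.lt_top).ne
  have hA' : 0 < volume.real A := ENNReal.toReal_pos hA hAt
  have hc : IntegrableOn (fun _ : Rn n => c) Q volume := integrableOn_const hQt
  have h1 : (⨍ y in A, b y) - c = (∫ y in A, (b y - c)) / volume.real A := by
    rw [setAverage_eq, integral_sub (hb.mono_set hAQ) (hc.mono_set hAQ), setIntegral_const]
    simp only [smul_eq_mul]
    field_simp
  rw [h1, abs_div, abs_of_pos hA']
  gcongr
  refine (abs_integral_le_integral_abs).trans ?_
  exact setIntegral_mono_set (hb.sub hc).abs (ae_of_all _ fun _ => abs_nonneg _)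
    (hAQ.eventuallyLE)

theorem exists_abs_average_closedBall_sub_le (hb : LocallyIntegrable b volume) {K : ℝ}
    (hK : ∀ (a : Rn n) (r : ℝ), 0 < r →
      ∫ x in cube a r, |b x - ⨍ y in cube a r, b y| ≤ K * r ^ (n + β)) :
    ∃ L : ℝ, 0 ≤ L ∧ ∀ (a y : Rn n) (ρ σ : ℝ), 0 < ρ → ρ ≤ σ →
      Metric.closedBall y σ ⊆ cube a (4 * ρ) →
      |(⨍ z in Metric.closedBall y σ, b z) - ⨍ z in cube a (4 * ρ), b z| ≤ L * ρ ^ β := by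
  have hω : 0 < volume.real (Metric.ball (0 : Rn n) 1) :=
    ENNReal.toReal_pos (Metric.measure_ball_pos _ _ one_pos).ne' measure_ball_lt_top.ne
  have hK0 : 0 ≤ K := by
    have := (integral_nonneg fun _ => abs_nonneg _).trans (hK 0 1 one_pos)
    simpa using this
  refine ⟨K * 4 ^ (n + β) / volume.real (Metric.ball (0 : Rn n) 1), by positivity,
    fun a y ρ σ hρ hρσ hsub => ?_⟩
  have hσ : 0 < σ := hρ.trans_le hρσ
  refine (abs_setAverage_sub_le hsub
    (Metric.measure_closedBall_pos _ _ hσ).ne' (volume_cube_ne_top _ _)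
    (integrableOn_cube hb _ _) _).trans ?_
  have hvol : ρ ^ n * volume.real (Metric.ball (0 : Rn n) 1) ≤
      volume.real (Metric.closedBall y σ) := by
    rw [Measure.addHaar_real_closedBall _ _ hσ.le, finrank_euclideanSpace_fin]
    gcongr
  have h4 : (0 : ℝ) < 4 * ρ := by positivity
  calc _ ≤ K * (4 * ρ) ^ (n + β) / (ρ ^ n * volume.real (Metric.ball (0 : Rn n) 1)) := by
        gcongr
        exact hK a _ h4
    _ = _ := by
        rw [Real.mul_rpow (by norm_num) hρ.le, Real.rpow_add hρ, Real.rpow_natCast]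
        field_simp

theorem isLip_extend (hβ0 : 0 < β) (hβ1 : β ≤ 1) {C : ℝ} (hC : 0 ≤ C) {E : Set (Rn n)}
    (hE : E.Nonempty) (h : ∀ x ∈ E, ∀ y ∈ E, |b x - b y| ≤ C * ‖x - y‖ ^ β) :
    ∃ g, IsLip β g ∧ EqOn b g E := by
  have hsub : ∀ x y z : Rn n, ‖x - z‖ ^ β ≤ ‖x - y‖ ^ β + ‖y - z‖ ^ β := fun x y z =>
    (Real.rpow_le_rpow (norm_nonneg _) (norm_sub_le_norm_sub_add_norm_sub x y z) hβ0.le).trans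
      (Real.rpow_add_le_add_rpow (norm_nonneg _) (norm_nonneg _) hβ0.le hβ1)
  have : Nonempty E := hE.to_subtype
  have hbdd : ∀ x : Rn n, BddBelow (range fun y : E => b y + C * ‖x - y‖ ^ β) := by
    obtain ⟨y₀, hy₀⟩ := hE
    refine fun x => ⟨b y₀ - C * ‖x - y₀‖ ^ β, ?_⟩
    rintro _ ⟨y, rfl⟩
    have h1 := (abs_le.1 (h y₀ hy₀ y y.2)).2
    have h2 := mul_le_mul_of_nonneg_left (hsub y₀ x y) hC
    rw [norm_sub_rev y₀ x] at h2
    simp only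
    linarith
  have hle : ∀ x z : Rn n, (⨅ y : E, (b y + C * ‖x - y‖ ^ β)) ≤
      (⨅ y : E, (b y + C * ‖z - y‖ ^ β)) + C * ‖x - z‖ ^ β := by
    intro x z
    rw [← sub_le_iff_le_add]
    refine le_ciInf fun y => ?_
    have h1 := ciInf_le (hbdd x) y
    have h2 := mul_le_mul_of_nonneg_left (hsub x z y) hC
    linarith
  refine ⟨fun x => ⨅ y : E, (b y + C * ‖x - y‖ ^ β), ⟨C + 1, by positivity, fun x z => ?_⟩,
    fun x hx => le_antisymm (le_ciInf fun y => ?_) ?_⟩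
  · have h1 := hle x z
    have h2 := hle z x
    rw [norm_sub_rev z x] at h2
    have h3 : C * ‖x - z‖ ^ β ≤ (C + 1) * ‖x - z‖ ^ β := by gcongr; linarith
    refine le_trans (abs_le.2 ⟨?_, ?_⟩) h3 <;> linarith
  · have := (abs_le.1 (h x hx y y.2)).2
    linarith
  · refine (ciInf_le (hbdd x) ⟨x, hx⟩).trans_eq ?_
    simp [Real.zero_rpow hβ0.ne']

/-- Campanato's characterization of Hölder continuity. -/
theorem memLip_of_integral_abs_sub_average_le (hβ0 : 0 < β) (hβ1 : β ≤ 1)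
    (hb : LocallyIntegrable b volume) {K : ℝ}
    (hK : ∀ (a : Rn n) (r : ℝ), 0 < r →
      ∫ x in cube a r, |b x - ⨍ y in cube a r, b y| ≤ K * r ^ (n + β)) :
    MemLip β b := by
  obtain ⟨L, hL, hball⟩ := exists_abs_average_closedBall_sub_le hb hK
  have h2β : (2 : ℝ)⁻¹ ^ β < 1 := Real.rpow_lt_one (by norm_num) (by norm_num) hβ0
  set κ : ℝ := (2 : ℝ)⁻¹ ^ β with hκ
  have hκ0 : 0 < κ := by positivity
  have hstep : ∀ (x : Rn n) (ρ : ℝ), 0 < ρ → |(⨍ z in Metric.closedBall x (2 * ρ), b z) -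
      ⨍ z in Metric.closedBall x ρ, b z| ≤ 2 * L * ρ ^ β := by
    intro x ρ hρ
    have hsub := closedBall_subset_cube x (2 * ρ)
    rw [← mul_assoc, show (2 : ℝ) * 2 = 4 by norm_num] at hsub
    have h1 := hball _ x ρ (2 * ρ) hρ (by linarith) hsub
    have h2 := hball _ x ρ ρ hρ le_rfl
      ((Metric.closedBall_subset_closedBall (by linarith)).trans hsub)
    rw [abs_sub_comm] at h2
    refine (abs_sub_le _ _ _).trans ((add_le_add h1 h2).trans_eq (by ring))
  have hleb := IsUnifLocDoublingMeasure.ae_tendsto_average (μ := (volume : Measure (Rn n))) hb 1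
  set E := {x : Rn n | ∀ d : ℝ, 0 < d →
    |(⨍ z in Metric.closedBall x d, b z) - b x| ≤ 2 * L * d ^ β / (1 - κ)} with hE
  have hEae : ∀ᵐ x, x ∈ E := by
    filter_upwards [hleb] with x hx d hd
    have hδ : Tendsto (fun k : ℕ => d * 2⁻¹ ^ k) atTop (𝓝[>] 0) := by
      refine tendsto_nhdsWithin_iff.2 ⟨?_, Eventually.of_forall fun k => ?_⟩
      · simpa using (tendsto_pow_atTop_nhds_zero_of_lt_one (r := (2 : ℝ)⁻¹) (by norm_num)
          (by norm_num)).const_mul d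
      · exact mem_Ioi.2 (by positivity)
    have ht := hx (fun _ => x) _ hδ (Eventually.of_forall fun k => by
      simp only [one_mul]; exact Metric.mem_closedBall_self (by positivity))
    have := dist_le_of_le_geometric_of_tendsto₀ κ (2 * L * d ^ β) h2β (fun k => ?_) ht
    · simpa [Real.dist_eq] using this
    · have h := hstep x (d * 2⁻¹ ^ (k + 1)) (by positivity)
      rw [show 2 * (d * (2 : ℝ)⁻¹ ^ (k + 1)) = d * 2⁻¹ ^ k by rw [pow_succ]; ring] at h
      rw [Real.dist_eq]
      refine h.trans ?_
      rw [mul_assoc (2 * L), hκ, ← Real.rpow_natCast _ k, ← Real.rpow_mul (by norm_num),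
        mul_comm β, Real.rpow_mul (by norm_num), ← Real.mul_rpow hd.le (by positivity),
        Real.rpow_natCast]
      gcongr 2 * L * (d * ?_) ^ β
      exact pow_le_pow_of_le_one (by norm_num) (by norm_num) (Nat.le_succ k)
  have hlip : ∀ x ∈ E, ∀ y ∈ E,
      |b x - b y| ≤ (2 * L + 4 * L / (1 - κ)) * ‖x - y‖ ^ β := by
    intro x hx y hy
    rcases eq_or_ne x y with rfl | hxy
    · simp [Real.zero_rpow hβ0.ne']
    have hd : 0 < ‖x - y‖ := norm_pos_iff.2 (sub_ne_zero.2 hxy)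
    have hsub := closedBall_subset_cube x (2 * ‖x - y‖)
    rw [← mul_assoc, show (2 : ℝ) * 2 = 4 by norm_num] at hsub
    have h1 := hball _ x _ _ hd le_rfl
      ((Metric.closedBall_subset_closedBall (by linarith)).trans hsub)
    have h2 := hball _ y _ _ hd le_rfl ((Metric.closedBall_subset_closedBall' (by
      rw [dist_comm, dist_eq_norm]; linarith)).trans hsub)
    have h3 := hx _ hd
    have h4 := hy _ hd
    rw [abs_le] at h1 h2 h3 h4
    have h5 : (2 * L + 4 * L / (1 - κ)) * ‖x - y‖ ^ β = 2 * (L * ‖x - y‖ ^ β) +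
      2 * (2 * L * ‖x - y‖ ^ β / (1 - κ)) := by ring
    rw [h5, abs_le]
    constructor <;> linarith
  have hne : E.Nonempty := hEae.exists
  have h1κ : 0 < 1 - κ := by linarith
  obtain ⟨g, hg, hbg⟩ := isLip_extend hβ0 hβ1 (by positivity) hne hlip
  exact ⟨g, hg, hEae.mono fun x hx => hbg hx⟩

end Campanato

section Transfer

variable {n : ℕ}

theorem ClassB.exists_modular_maximal_le {r : Rn n → ℝ} (hr : ClassB r) :
    ∃ D : ℝ≥0, 0 < D ∧ ∀ h : Rn n → ℝ, AEMeasurable h volume → modular r h 1 ≤ 1 →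
      modular r (maximal h) D ≤ 1 := by
  obtain ⟨hP, C, hC⟩ := hr
  refine ⟨C + 1, by positivity, fun h hh hm => ?_⟩
  have h1 := (hC h ⟨hh, 1, one_pos, hm.trans_lt ENNReal.one_lt_top⟩).2
  have h2 : varNorm r (maximal h) < (C + 1 : ℝ≥0) := by
    refine h1.trans_lt ?_
    calc (C : ℝ≥0∞) * varNorm r h ≤ C * (1 : ℝ≥0) := by
          gcongr; exact varNorm_le_of_modular_le one_pos hm
      _ = C := by simp
      _ < (C + 1 : ℝ≥0) := by exact_mod_cast lt_add_one C
  obtain ⟨t, ht, hmt, htC⟩ := exists_modular_le_of_varNorm_lt h2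
  refine le_trans (modular_mono (fun x => zero_le_one.trans (hP.one_le x))
    (ae_of_all _ fun x => ?_)) hmt
  gcongr

/-- An operator which is dominated, after normalization, by a power of the maximal function is
bounded on the correspondingly rescaled spaces. -/
theorem boundedVar_of_le_maximal_rpow {p q r : Rn n → ℝ} (hr : ClassB r) (hp : ∀ x, 1 ≤ p x)
    {T : (Rn n → ℝ) → Rn n → ℝ≥0∞} {η : ℝ} (hη : 0 < η) (hq : ∀ x, η * q x = r x)
    (hT : ∀ f, AEMeasurable f volume → AEMeasurable (T f) volume) {B : ℝ≥0} (hB : 0 < B)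
    (h : ∀ f : Rn n → ℝ, AEMeasurable f volume → ∀ t : ℝ≥0, 0 < t → modular p f t ≤ 1 →
      ∃ g : Rn n → ℝ, AEMeasurable g volume ∧ modular r g 1 ≤ 1 ∧
        ∀ᵐ x, T f x ≤ B * t * maximal g x ^ η) :
    BoundedVar T p q := by
  obtain ⟨D, hD, hmax⟩ := hr.exists_modular_maximal_le
  have hDη : 0 < D ^ η := NNReal.rpow_pos hD
  refine boundedVar_of_modular (C := B * D ^ η) hp (mul_pos hB hDη)
    fun f hf t ht hm => ⟨hT f hf, ?_⟩
  obtain ⟨g, hg, hgm, hle⟩ := h f hf t ht hm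
  refine le_trans (lintegral_mono_ae ?_) (hmax g hg hgm)
  filter_upwards [hle] with x hx
  have hqx : 0 ≤ q x := by
    have := hr.1.one_le x
    rw [← hq x] at this
    exact (pos_of_mul_pos_right (one_pos.trans_le this) hη.le).le
  rw [← hq x, ENNReal.rpow_mul]
  refine ENNReal.rpow_le_rpow ?_ hqx
  simp only [enorm_eq_self]
  rw [ENNReal.div_rpow_of_nonneg _ _ hη.le]
  refine ENNReal.div_le_of_le_mul (hx.trans_eq ?_)
  have h0 : (D : ℝ≥0∞) ^ η ≠ 0 := by
    rw [← ENNReal.coe_rpow_of_ne_zero hD.ne']; exact_mod_cast hDη.ne'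
  have h1 : (D : ℝ≥0∞) ^ η ≠ ∞ := by
    rw [← ENNReal.coe_rpow_of_ne_zero hD.ne']; simp
  push_cast
  rw [← ENNReal.coe_rpow_of_ne_zero hD.ne'] at h0 h1 ⊢
  calc (B : ℝ≥0∞) * t * maximal g x ^ η
      = B * t * (maximal g x ^ η / ((D ^ η : ℝ≥0) : ℝ≥0∞) * ((D ^ η : ℝ≥0) : ℝ≥0∞)) := by
        rw [ENNReal.div_mul_cancel h0 h1]
    _ = _ := by ring

theorem lintegral_div_le_rpow {A : Set (Rn n)} {u h v : Rn n → ℝ≥0∞} {θ : ℝ}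
    (hθ0 : 0 ≤ θ) (hθ1 : θ ≤ 1) (hh : AEMeasurable h volume) (hv : AEMeasurable v volume)
    (hu : ∀ y, u y = h y ^ (1 - θ) * v y ^ θ) {V : ℝ≥0∞} (hV : ∫⁻ y in A, v y ≤ V) :
    (∫⁻ y in A, u y) / volume A ^ (1 - θ) ≤
      ((∫⁻ y in A, h y) / volume A) ^ (1 - θ) * V ^ θ := by
  have h1θ : 0 ≤ 1 - θ := by linarith
  rw [ENNReal.div_rpow_of_nonneg _ _ h1θ, div_eq_mul_inv, div_eq_mul_inv, mul_right_comm]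
  gcongr
  simp only [hu]
  refine (ENNReal.lintegral_mul_norm_pow_le hh.restrict hv.restrict h1θ hθ0
    (by ring)).trans ?_
  gcongr

theorem ClassP.const_mul {r : Rn n → ℝ} (hr : ClassP r) {c : ℝ} (hc : 1 ≤ c) :
    ClassP (fun x => c * r x) where
  measurable := hr.measurable.const_mul c
  one_le x := by nlinarith [hr.one_le x]
  one_lt_lower := by
    refine hr.one_lt_lower.trans_le (essInf_mono_ae (ae_of_all _ fun x => ?_))
    exact ENNReal.ofReal_le_ofReal (by nlinarith [hr.one_le x])
  upper_lt_top := by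
    refine lt_of_le_of_lt (essSup_le_of_ae_le (ENNReal.ofReal c * upperExp r) ?_)
      (ENNReal.mul_lt_top ENNReal.ofReal_lt_top hr.upper_lt_top)
    filter_upwards [ENNReal.ae_le_essSup fun x => ENNReal.ofReal (r x)] with x hx
    rw [ENNReal.ofReal_mul (by linarith)]
    gcongr
    exact hx

theorem enorm_rpow_abs_div (a : ℝ) {t : ℝ≥0} (ht : 0 < t) {c : ℝ} (hc : 0 ≤ c) :
    ‖(|a| / (t : ℝ)) ^ c‖ₑ = (‖a‖ₑ / (t : ℝ≥0∞)) ^ c := by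
  rw [Real.enorm_of_nonneg (by positivity), ← ENNReal.ofReal_rpow_of_nonneg (by positivity) hc,
    ENNReal.ofReal_div_of_pos (by exact_mod_cast ht), Real.enorm_eq_ofReal_abs,
    ENNReal.ofReal_coe_nnreal]

theorem lintegral_div_coe (f : Rn n → ℝ) (A : Set (Rn n)) {t : ℝ≥0} (ht : 0 < t) :
    ∫⁻ y in A, ‖f y‖ₑ = t * ∫⁻ y in A, ‖f y‖ₑ / t := by
  rw [← lintegral_const_mul' _ _ (by simp)]
  congr 1; ext y
  rw [ENNReal.mul_div_cancel (by simp [ht.ne']) (by simp)]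

theorem ClassB.const_mul {r : Rn n → ℝ} (hr : ClassB r) {c : ℝ} (hc : 1 ≤ c) :
    ClassB (fun x => c * r x) := by
  have hP := hr.1.const_mul hc
  have hc0 : 0 < c := by linarith
  refine ⟨hP, boundedVar_of_le_maximal_rpow hr hP.one_le (η := c⁻¹) (inv_pos.2 hc0)
    (fun x => by field_simp) (fun f hf => (measurable_maximal hf).aemeasurable) one_pos
    fun f hf t ht hm => ⟨fun y => (|f y| / t) ^ c, ?_, ?_, ae_of_all _ fun x => ?_⟩⟩
  · exact (hf.abs.div_const _).pow_const c
  · refine le_trans (lintegral_mono fun x => ?_) hm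
    rw [enorm_rpow_abs_div _ ht hc0.le, ENNReal.rpow_mul]
    simp
  · refine iSup_le fun a => iSup_le fun s => iSup_le fun hs => iSup_le fun hx => ?_
    rw [lintegral_div_coe f _ ht, mul_div_assoc, ENNReal.coe_one, one_mul]
    gcongr
    have h0 := volume_cube_ne_zero a hs
    have h1 := volume_cube_ne_top a s
    have hθ : 1 - (1 - c⁻¹) = c⁻¹ := by ring
    have key := lintegral_div_le_rpow (n := n) (A := cube a s) (u := fun y => ‖f y‖ₑ / t)
      (h := fun y => ‖(|f y| / (t : ℝ)) ^ c‖ₑ) (v := fun _ => 1) (θ := 1 - c⁻¹)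
      (V := volume (cube a s)) (by linarith [inv_le_one_of_one_le₀ hc])
      (by linarith [inv_pos.2 hc0]) (((hf.abs.div_const _).pow_const c).enorm) aemeasurable_const
      (fun y => by
        rw [hθ, enorm_rpow_abs_div _ ht hc0.le, ← ENNReal.rpow_mul, mul_inv_cancel₀ hc0.ne']
        simp) (by simp)
    rw [hθ] at key
    calc (∫⁻ y in cube a s, ‖f y‖ₑ / t) / volume (cube a s)
        = (∫⁻ y in cube a s, ‖f y‖ₑ / t) / volume (cube a s) ^ c⁻¹ /
            volume (cube a s) ^ (1 - c⁻¹) := by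
          have e : volume (cube a s) = volume (cube a s) ^ c⁻¹ * volume (cube a s) ^ (1 - c⁻¹) := by
            rw [← ENNReal.rpow_add _ _ h0 h1]; simp
          conv_lhs => rw [e]
          rw [div_eq_mul_inv, ENNReal.mul_inv (.inl (by simp [h0, h1])) (.inl (by simp [h0, h1])),
            ← mul_assoc, ← div_eq_mul_inv, ← div_eq_mul_inv]
      _ ≤ ((∫⁻ y in cube a s, ‖(|f y| / (t : ℝ)) ^ c‖ₑ) / volume (cube a s)) ^ c⁻¹ := by
          refine ENNReal.div_le_of_le_mul key
      _ ≤ _ := by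
          gcongr
          exact le_maximal _ hs hx

end Transfer

section Lipschitz

variable {n : ℕ} {β : ℝ} {g b : Rn n → ℝ}

theorem IsLip.continuous (hβ : 0 < β) (hg : IsLip β g) : Continuous g := by
  obtain ⟨C, hC, h⟩ := hg
  refine continuous_iff_continuousAt.2 fun x => tendsto_iff_norm_sub_tendsto_zero.2 ?_
  refine squeeze_zero (fun _ => norm_nonneg _) (fun y => h y x) ?_
  have : Continuous fun y : Rn n => C * ‖y - x‖ ^ β :=
    continuous_const.mul ((by fun_prop : Continuous fun y : Rn n => ‖y - x‖).rpow_const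
      fun _ => .inr hβ.le)
  simpa [Real.zero_rpow hβ.ne'] using this.tendsto x

theorem IsLip.exists_enorm_sub_le (hn : 0 < n) (hβ : 0 < β) (hg : IsLip β g) :
    ∃ B : ℝ≥0, 0 < B ∧ ∀ (a : Rn n) (r : ℝ), 0 < r → ∀ x ∈ cube a r, ∀ y ∈ cube a r,
      ‖g x - g y‖ₑ ≤ B * volume (cube a r) ^ (β / (n : ℝ)) := by
  obtain ⟨C, hC, h⟩ := hg
  have hn' : (0 : ℝ) < n := by exact_mod_cast hn
  refine ⟨Real.toNNReal (C * n ^ β), Real.toNNReal_pos.2 (by positivity),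
    fun a r hr x hx y hy => ?_⟩
  rw [volume_cube_rpow hn a hr, ← ENNReal.ofReal, ← ENNReal.ofReal_mul (by positivity),
    Real.enorm_eq_ofReal_abs]
  refine ENNReal.ofReal_le_ofReal ((h x y).trans ?_)
  rw [mul_assoc, ← Real.mul_rpow hn'.le hr.le]
  gcongr
  exact norm_sub_le_of_mem_cube hr.le hx hy

theorem enorm_sub_setAverage_le {A : Set (Rn n)} (hA0 : volume A ≠ 0) (hA : volume A ≠ ∞)
    (hb : IntegrableOn b A volume) (c : ℝ) :
    ‖c - ⨍ y in A, b y‖ₑ ≤ (∫⁻ y in A, ‖c - b y‖ₑ) / volume A := by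
  have hA' : 0 < volume.real A := ENNReal.toReal_pos hA0 hA
  have hc : IntegrableOn (fun _ : Rn n => c) A volume := integrableOn_const hA
  have h1 : c - (⨍ y in A, b y) = (volume.real A)⁻¹ * ∫ y in A, (c - b y) := by
    rw [setAverage_eq, integral_sub hc hb, setIntegral_const]
    simp only [smul_eq_mul]
    field_simp
  rw [h1, enorm_mul, div_eq_mul_inv, mul_comm, enorm_inv hA'.ne']
  gcongr
  · exact enorm_integral_le_lintegral_enorm _
  · rw [Real.enorm_of_nonneg hA'.le, ofReal_measureReal hA]

theorem oscSup_lt_top {s : Rn n → ℝ} (hn : 0 < n) (K : ℝ≥0)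
    (h : ∀ (a : Rn n) (r : ℝ), 0 < r →
      varNorm s ((cube a r).indicator (fun x => b x - ⨍ y in cube a r, b y)) ≤
        K * volume (cube a r) ^ (β / (n : ℝ)) *
          varNorm s ((cube a r).indicator (fun _ => (1 : ℝ)))) :
    oscSup β b s < ∞ := by
  refine lt_of_le_of_lt (iSup_le fun a => iSup_le fun r => iSup_le fun hr => ?_)
    (ENNReal.coe_lt_top (r := K))
  refine (mul_le_mul_right (ENNReal.div_le_of_le_mul (h a r hr)) _).trans ?_
  have h0 : volume (cube a r) ^ (β / (n : ℝ)) ≠ 0 := by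
    rw [volume_cube_rpow hn a hr]; simpa using Real.rpow_pos_of_pos hr β
  have h1 : volume (cube a r) ^ (β / (n : ℝ)) ≠ ∞ := by
    rw [volume_cube_rpow hn a hr]; simp
  rw [mul_comm (K : ℝ≥0∞), ← mul_assoc, one_div, ENNReal.inv_mul_cancel h0 h1, one_mul]

theorem MemLip.oscSup_lt_top (hn : 0 < n) (hβ : 0 < β) (hb : LocallyIntegrable b volume)
    (h : MemLip β b) {s : Rn n → ℝ} (hs : ClassB s) : oscSup β b s < ∞ := by
  obtain ⟨g, hg, hbg⟩ := h
  obtain ⟨B, hB, hBg⟩ := hg.exists_enorm_sub_le hn hβ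
  refine VarLebesgue.oscSup_lt_top hn B fun a r hr => ?_
  have h1 : volume (cube a r) ^ (β / (n : ℝ)) ≠ ∞ := by
    rw [volume_cube_rpow hn a hr]; simp
  have hv : B * volume (cube a r) ^ (β / (n : ℝ)) =
      ((B * (volume (cube a r) ^ (β / (n : ℝ))).toNNReal : ℝ≥0) : ℝ≥0∞) := by
    rw [ENNReal.coe_mul, ENNReal.coe_toNNReal h1]
  have hpos : 0 < B * (volume (cube a r) ^ (β / (n : ℝ))).toNNReal := by
    refine mul_pos hB (ENNReal.toNNReal_pos ?_ h1)
    rw [volume_cube_rpow hn a hr]; simpa using Real.rpow_pos_of_pos hr β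
  rw [hv]
  refine varNorm_le_mul_of_ae_le (fun x => zero_le_one.trans (hs.1.one_le x)) hpos ?_
  rw [← hv]
  filter_upwards [hbg] with x hx
  by_cases hxQ : x ∈ cube a r
  · simp only [hxQ, indicator_of_mem, enorm_one, mul_one]
    refine (enorm_sub_setAverage_le (volume_cube_ne_zero a hr) (volume_cube_ne_top a r)
      (integrableOn_cube hb a r) _).trans (ENNReal.div_le_of_le_mul ?_)
    rw [← setLIntegral_const]
    refine lintegral_mono_ae ?_
    filter_upwards [ae_restrict_of_ae hbg, ae_restrict_mem (measurableSet_cube a r)] with y hy hyQ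
    rw [hx, hy]
    exact hBg a r hr x hxQ y hyQ
  · simp [hxQ]

end Lipschitz

section Commutator

variable {n : ℕ} {α β γ : ℝ} {b : Rn n → ℝ} {p q s : Rn n → ℝ}

theorem aemeasurable_maximalCommutator (hn : 0 < n) (hαn : α ≤ n) (hβ : 0 < β)
    (h : MemLip β b) {f : Rn n → ℝ} (hf : AEMeasurable f volume) :
    AEMeasurable (maximalCommutator α b f) volume := by
  obtain ⟨g, hg, hbg⟩ := h
  have hgc := hg.continuous hβ
  have hn' : (0 : ℝ) < n := by exact_mod_cast hn
  have hθ : 0 ≤ 1 - α / (n : ℝ) := by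
    rw [sub_nonneg, div_le_one hn']; exact hαn
  have hlsc := lowerSemicontinuous_iSup_cube (n := n) (K := fun x y => ‖g x - g y‖ₑ * ‖f y‖ₑ) hθ
    (fun x => ((hgc.measurable.const_sub (g x)).enorm.aemeasurable).mul hf.enorm) fun y => by
      have h1 : Continuous fun x => ‖g x - g y‖ₑ := (hgc.sub continuous_const).enorm
      exact ((ENNReal.continuous_mul_const (by simp)).comp h1).lowerSemicontinuous
  refine ⟨_, hlsc.measurable, ?_⟩
  filter_upwards [hbg] with x hx
  simp only [maximalCommutator]
  congr! 7 with a r _ _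
  refine lintegral_congr_ae (ae_restrict_of_ae (hbg.mono fun y hy => ?_))
  simp only [hx, hy]

theorem ClassBPair.exponent_pos (hn : 0 < n) (hγn : γ < n) (h : ClassBPair γ p q) (x : Rn n) :
    0 < q x := by
  have hn' : (0 : ℝ) < n := by exact_mod_cast hn
  have h1 := h.classB.1.one_le x
  rw [one_le_div hn'] at h1
  have h2 : 0 < q x * (n - γ) := hn'.trans_le h1
  exact (pos_iff_pos_of_mul_pos h2).2 (by linarith)

/-- The maximal commutator of a Lipschitz function is dominated by a fractional maximal function,
and the latter by a power of a Hardy-Littlewood maximal function. -/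
theorem MemLip.boundedVar_maximalCommutator (hn : 0 < n) (hα : 0 < α) (hβ : 0 < β)
    (hαβ : α + β < n) (h : MemLip β b) (hpq : ClassBPair (α + β) p q) :
    BoundedVar (maximalCommutator α b) p q := by
  have hn' : (0 : ℝ) < n := by exact_mod_cast hn
  have hq := hpq.exponent_pos hn hαβ
  have hp1 := hpq.classP.one_le
  have hr1 := hpq.classB.1.one_le
  set r : Rn n → ℝ := fun x => q x * ((n : ℝ) - (α + β)) / (n : ℝ) with hr
  set θ : ℝ := (α + β) / n with hθ
  have hθ0 : 0 < θ := by positivity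
  have hθ1 : θ < 1 := (div_lt_one hn').2 hαβ
  have hrq : ∀ x, r x = (1 - θ) * q x := fun x => by
    simp only [hr, hθ]; field_simp
  have hpr : ∀ x, p x / r x * (1 - θ) = 1 - p x * θ := fun x => by
    have h1 := hpq.inv_eq x
    have h2 : p x ≠ 0 := (one_pos.trans_le (hp1 x)).ne'
    have h3 : 1 - θ ≠ 0 := by linarith
    have h4 : p x / q x = 1 - p x * θ := by
      rw [div_eq_mul_one_div, h1, ← hθ]; field_simp
    rw [← h4, hrq x]
    have := (hq x).ne'
    field_simp
  have hmeas : ∀ f, AEMeasurable f volume → AEMeasurable (maximalCommutator α b f) volume :=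
    fun f hf => aemeasurable_maximalCommutator hn (by linarith) hβ h hf
  obtain ⟨g, hg, hbg⟩ := h
  obtain ⟨B, hB, hBg⟩ := hg.exists_enorm_sub_le hn hβ
  refine boundedVar_of_le_maximal_rpow hpq.classB hp1 (η := 1 - θ) (by linarith)
    (fun x => (hrq x).symm) hmeas hB fun f hf t ht hm =>
      ⟨fun y => (|f y| / t) ^ (p y / r y), ?_, ?_, ?_⟩
  · exact (hf.abs.div_const _).pow (hpq.classP.measurable.div hpq.classB.1.measurable)
  · refine le_trans (lintegral_mono fun x => ?_) hm
    have hr0 : 0 < r x := one_pos.trans_le (hr1 x)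
    have hp0 : 0 < p x := one_pos.trans_le (hp1 x)
    rw [enorm_rpow_abs_div _ ht (by positivity), ENNReal.coe_one, div_one, ← ENNReal.rpow_mul,
      div_mul_cancel₀ _ hr0.ne']
  · filter_upwards [hbg] with x hx
    refine iSup_le fun a => iSup_le fun s => iSup_le fun hs => iSup_le fun hxQ => ?_
    have h0 := volume_cube_ne_zero a hs
    have h1 := volume_cube_ne_top a s
    set V := volume (cube a s) with hV
    have key := lintegral_div_le_rpow (n := n) (A := cube a s) (u := fun y => ‖f y‖ₑ / t)
      (h := fun y => ‖(|f y| / (t : ℝ)) ^ (p y / r y)‖ₑ) (v := fun y => (‖f y‖ₑ / t) ^ p y)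
      (θ := θ) (V := 1) hθ0.le hθ1.le
      ((hf.abs.div_const _).pow (hpq.classP.measurable.div hpq.classB.1.measurable)).enorm
      ((hf.enorm.div_const _).pow hpq.classP.measurable)
      (fun y => by
        have hr0 : 0 < r y := one_pos.trans_le (hr1 y)
        have hp0 : 0 < p y := one_pos.trans_le (hp1 y)
        have hp1' : 0 ≤ 1 - p y * θ := by
          rw [← hpr y]; have : 0 < 1 - θ := by linarith
          positivity
        rw [enorm_rpow_abs_div _ ht (by positivity), ← ENNReal.rpow_mul, ← ENNReal.rpow_mul,
          hpr y, ← ENNReal.rpow_add_of_nonneg _ _ hp1' (by positivity)]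
        simp)
      ((setLIntegral_le_lintegral _ _).trans hm)
    rw [ENNReal.one_rpow, mul_one] at key
    have hVβ : V ^ (β / (n : ℝ)) ≠ 0 := by simp [h0, h1]
    have hVβ' : V ^ (β / (n : ℝ)) ≠ ∞ := by simp [h0, h1]
    have hVsplit : V ^ (1 - α / (n : ℝ)) = V ^ (β / (n : ℝ)) * V ^ (1 - θ) := by
      rw [← ENNReal.rpow_add _ _ h0 h1, hθ]; congr 1; ring
    calc (∫⁻ y in cube a s, ‖b x - b y‖ₑ * ‖f y‖ₑ) / V ^ (1 - α / (n : ℝ))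
        ≤ (∫⁻ y in cube a s, B * V ^ (β / (n : ℝ)) * ‖f y‖ₑ) / V ^ (1 - α / (n : ℝ)) := by
          refine ENNReal.div_le_div_right (lintegral_mono_ae ?_) _
          filter_upwards [ae_restrict_of_ae hbg, ae_restrict_mem (measurableSet_cube a s)]
            with y hy hyQ
          rw [hx, hy]
          gcongr
          exact hBg a s hs x hxQ y hyQ
      _ = B * t * ((∫⁻ y in cube a s, ‖f y‖ₑ / t) / V ^ (1 - θ)) := by
          rw [lintegral_const_mul' _ _ (ENNReal.mul_ne_top (by simp) hVβ'),
            lintegral_div_coe f _ ht, hVsplit, mul_right_comm, mul_comm (V ^ (β / (n : ℝ))),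
            ENNReal.mul_div_mul_right _ _ hVβ hVβ', ← mul_assoc, mul_div_assoc]
      _ ≤ _ := by
          gcongr
          refine key.trans ?_
          have : 0 ≤ 1 - θ := by linarith
          gcongr
          exact le_maximal _ hs hxQ

theorem varNorm_indicator_le (hp : ∀ x, 1 ≤ p x) (hq : ∀ x, 0 < q x) {θ : ℝ} (hθ : 0 ≤ θ)
    (hpq : ∀ x, 1 / q x = 1 / p x - θ) {A : Set (Rn n)} (hA : MeasurableSet A)
    (hA0 : volume A ≠ 0) (hA1 : volume A ≠ ∞) :
    varNorm p (A.indicator fun _ => (1 : ℝ)) ≤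
      2 * volume A ^ θ * varNorm q (A.indicator fun _ => (1 : ℝ)) := by
  have hVθ0 : volume A ^ θ ≠ 0 := by simp [hA0, hA1]
  have hVθ1 : volume A ^ θ ≠ ∞ := ENNReal.rpow_ne_top_of_nonneg hθ hA1
  have hC : 2 * volume A ^ θ = ((2 * (volume A ^ θ).toNNReal : ℝ≥0) : ℝ≥0∞) := by
    rw [ENNReal.coe_mul, ENNReal.coe_toNNReal hVθ1]; rfl
  rw [hC]
  refine varNorm_le_mul (mul_pos two_pos (ENNReal.toNNReal_pos hVθ0 hVθ1)) fun t ht hm => ?_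
  rw [modular_indicator_one (fun x => one_pos.trans_le (hp x)) hA]
  rw [modular_indicator_one hq hA] at hm
  have hpt : ∀ x, (((2 * (volume A ^ θ).toNNReal * t : ℝ≥0) : ℝ≥0∞))⁻¹ ^ p x ≤
      2⁻¹ * ((t : ℝ≥0∞)⁻¹ ^ q x + (volume A)⁻¹) := by
    intro x
    have hp0 : 0 < p x := one_pos.trans_le (hp x)
    have hsum : p x / q x + θ * p x = 1 := by
      rw [div_eq_mul_one_div, hpq x]; field_simp; ring
    rw [ENNReal.coe_mul, ← hC, ENNReal.mul_inv (.inr (by simp)) (.inr (by simp [ht.ne'])),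
      ENNReal.mul_inv (.inl (by simp)) (.inl (by simp)), ENNReal.mul_rpow_of_nonneg _ _ hp0.le,
      ENNReal.mul_rpow_of_nonneg _ _ hp0.le, mul_assoc]
    gcongr ?_ * ?_
    · simpa using ENNReal.rpow_le_rpow_of_exponent_ge
        (show (2 : ℝ≥0∞)⁻¹ ≤ 1 by simp) (hp x)
    · set X := (t : ℝ≥0∞)⁻¹ ^ q x with hX
      set Y := (volume A)⁻¹ with hY
      have e1 : (volume A ^ θ)⁻¹ ^ p x = Y ^ (θ * p x) := by
        rw [← ENNReal.inv_rpow, ENNReal.rpow_mul]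
      have e2 : (t : ℝ≥0∞)⁻¹ ^ p x = X ^ (p x / q x) := by
        rw [hX, ← ENNReal.rpow_mul, mul_div_cancel₀ _ (hq x).ne']
      have hpq0 : 0 ≤ p x / q x := div_nonneg hp0.le (hq x).le
      have hθp : 0 ≤ θ * p x := mul_nonneg hθ hp0.le
      calc (volume A ^ θ)⁻¹ ^ p x * (t : ℝ≥0∞)⁻¹ ^ p x
          ≤ (X + Y) ^ (θ * p x) * (X + Y) ^ (p x / q x) := by
            rw [e1, e2]
            gcongr
            · exact le_add_self
            · exact le_self_add
        _ = X + Y := by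
            rw [← ENNReal.rpow_add_of_nonneg _ _ hθp hpq0, add_comm (θ * p x), hsum, ENNReal.rpow_one]
  calc _ ≤ ∫⁻ x in A, 2⁻¹ * ((t : ℝ≥0∞)⁻¹ ^ q x + (volume A)⁻¹) := lintegral_mono hpt
    _ = 2⁻¹ * ((∫⁻ x in A, (t : ℝ≥0∞)⁻¹ ^ q x) + (volume A)⁻¹ * volume A) := by
        rw [lintegral_const_mul' _ _ (by simp), lintegral_add_right _ measurable_const,
          setLIntegral_const]
    _ ≤ 2⁻¹ * (1 + 1) := by
        gcongr
        exact (ENNReal.inv_mul_cancel hA0 hA1).le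
    _ = 1 := by
        rw [one_add_one_eq_two]; exact ENNReal.inv_mul_cancel (by simp) (by simp)

theorem ClassBPair.classB_right (hn : 0 < n) (hγ0 : 0 ≤ γ) (hγn : γ < n) (h : ClassBPair γ p q) :
    ClassB q := by
  have hn' : (0 : ℝ) < n := by exact_mod_cast hn
  have h1 : 0 < (n : ℝ) - γ := by linarith
  have := h.classB.const_mul (c := n / (n - γ)) ((one_le_div h1).2 (by linarith))
  convert this using 2 with x
  field_simp

theorem oscSup_lt_top_of_boundedVar (hn : 0 < n) (hα : 0 < α) (hβ : 0 < β) (hαβ : α + β < n)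
    (hb : LocallyIntegrable b volume) (hpq : ClassBPair (α + β) p q)
    (h : BoundedVar (maximalCommutator α b) p q) : oscSup β b q < ∞ := by
  have hn' : (0 : ℝ) < n := by exact_mod_cast hn
  have hq := hpq.exponent_pos hn hαβ
  have hp1 := hpq.classP.one_le
  obtain ⟨C, hC⟩ := h
  refine oscSup_lt_top hn (2 * C) fun a r hr => ?_
  have h0 := volume_cube_ne_zero a hr
  have h1 := volume_cube_ne_top a r
  have hQ := measurableSet_cube a r
  set V := volume (cube a r) with hV
  have hVα : V ^ (α / (n : ℝ)) ≠ 0 := by simp [h0, h1]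
  have hVα' : V ^ (α / (n : ℝ)) ≠ ∞ := by simp [h0, h1]
  have hmem : MemVarLp p ((cube a r).indicator fun _ => (1 : ℝ)) :=
    memVarLp_of_varNorm_lt_top (measurable_const.indicator hQ).aemeasurable
      (varNorm_indicator_one_ne_top hp1 hQ h1).lt_top
  have hlow : ∀ x, (V ^ (α / (n : ℝ))).toNNReal *
      ‖(cube a r).indicator (fun x => b x - ⨍ y in cube a r, b y) x‖ₑ ≤
      ‖maximalCommutator α b ((cube a r).indicator fun _ => (1 : ℝ)) x‖ₑ := by
    intro x
    by_cases hx : x ∈ cube a r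
    · rw [indicator_of_mem hx, enorm_eq_self, ENNReal.coe_toNNReal hVα']
      calc V ^ (α / (n : ℝ)) * ‖b x - ⨍ y in cube a r, b y‖ₑ
          ≤ V ^ (α / (n : ℝ)) * ((∫⁻ y in cube a r, ‖b x - b y‖ₑ) / V) := by
            gcongr
            exact enorm_sub_setAverage_le h0 h1 (integrableOn_cube hb a r) _
        _ = (∫⁻ y in cube a r, ‖b x - b y‖ₑ *
              ‖(cube a r).indicator (fun _ => (1 : ℝ)) y‖ₑ) / V ^ (1 - α / (n : ℝ)) := by
            rw [sub_eq_add_neg, add_comm, ENNReal.rpow_add _ _ h0 h1, ENNReal.rpow_neg,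
              ENNReal.rpow_one, div_eq_mul_inv _ V,
              div_eq_mul_inv _ ((V ^ (α / (n : ℝ)))⁻¹ * V),
              ENNReal.mul_inv (.inr h1) (.inr h0), inv_inv, mul_left_comm]
            congr 1
            refine setLIntegral_congr_fun hQ fun y hy => ?_
            simp [hy]
        _ ≤ _ := by
            rw [hV]
            exact le_iSup_of_le a (le_iSup_of_le r (le_iSup_of_le hr (le_iSup_of_le hx le_rfl)))
    · simp [hx]
  have h3 := (mul_varNorm_le_of_ae_le (fun x => (hq x).le) _ (ae_of_all _ hlow)).trans
    ((hC _ hmem).2)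
  rw [ENNReal.coe_toNNReal hVα'] at h3
  have h4 := varNorm_indicator_le hp1 hq (by positivity) hpq.inv_eq hQ h0 h1
  have hVsplit : V ^ ((α + β) / (n : ℝ)) = V ^ (α / (n : ℝ)) * V ^ (β / (n : ℝ)) := by
    rw [← ENNReal.rpow_add _ _ h0 h1, add_div]
  rw [← ENNReal.mul_le_mul_iff_right hVα hVα']
  refine h3.trans ((mul_le_mul_right h4 _).trans_eq ?_)
  rw [← hV, hVsplit, ENNReal.coe_mul, ENNReal.coe_ofNat]
  ring

theorem ClassB.exists_average_le (hs : ClassB s) :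
    ∃ K : ℝ≥0, ∀ (a : Rn n) (r : ℝ), 0 < r → ∀ h : Rn n → ℝ, AEMeasurable h volume →
      (∫⁻ y in cube a r, ‖h y‖ₑ) / volume (cube a r) ≤
        K * (varNorm s ((cube a r).indicator h) /
          varNorm s ((cube a r).indicator fun _ => (1 : ℝ))) := by
  obtain ⟨hP, C, hC⟩ := hs
  refine ⟨C + 1, fun a r hr h hh => ?_⟩
  have hQ := measurableSet_cube a r
  have hN0 := varNorm_indicator_one_ne_zero hP.one_le hQ (volume_cube_ne_zero a hr)
  have hN1 := varNorm_indicator_one_ne_top hP.one_le hQ (volume_cube_ne_top a r)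
  by_cases hfin : varNorm s ((cube a r).indicator h) = ∞
  · rw [hfin, ENNReal.top_div_of_ne_top hN1, ENNReal.mul_top (by positivity)]
    exact le_top
  rw [← mul_div_assoc, ENNReal.le_div_iff_mul_le (.inl hN0) (.inl hN1)]
  have hm := (hC _ (memVarLp_of_varNorm_lt_top (hh.indicator hQ) (lt_top_iff_ne_top.2 hfin))).2
  refine le_trans ?_ (hm.trans (mul_le_mul_left (by exact_mod_cast (lt_add_one C).le) _))
  rw [← ENNReal.le_div_iff_mul_le (.inl hN0) (.inl hN1)]
  refine ENNReal.le_of_forall_nnreal_lt fun c hc => ?_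
  rw [ENNReal.le_div_iff_mul_le (.inl hN0) (.inl hN1)]
  refine mul_varNorm_le_of_ae_le (fun x => zero_le_one.trans (hP.one_le x)) c
    (ae_of_all _ fun x => ?_)
  by_cases hx : x ∈ cube a r
  · rw [indicator_of_mem hx, enorm_one, mul_one, enorm_eq_self]
    refine hc.le.trans (le_trans (le_of_eq ?_) (le_maximal _ hr hx))
    congr 1
    refine setLIntegral_congr_fun hQ fun y hy => ?_
    simp [hy]
  · simp [hx]

theorem memLip_of_oscSup_lt_top (hn : 0 < n) (hβ0 : 0 < β) (hβ1 : β ≤ 1)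
    (hb : LocallyIntegrable b volume) (hs : ClassB s) (h : oscSup β b s < ∞) : MemLip β b := by
  obtain ⟨K, hK⟩ := hs.exists_average_le
  obtain ⟨D, hD⟩ : ∃ D : ℝ≥0, oscSup β b s = D := ⟨_, (ENNReal.coe_toNNReal h.ne).symm⟩
  refine memLip_of_integral_abs_sub_average_le hβ0 hβ1 hb (K := K * D) fun a r hr => ?_
  have h0 := volume_cube_ne_zero a hr
  have h1 := volume_cube_ne_top a r
  set m := ⨍ y in cube a r, b y with hm
  have hbm : AEMeasurable b volume := hb.aestronglyMeasurable.aemeasurable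
  have h2 := hK a r hr (fun x => b x - m) (hbm.sub_const m)
  have h3 : 1 / volume (cube a r) ^ (β / (n : ℝ)) *
      (varNorm s ((cube a r).indicator (fun x => b x - m)) /
        varNorm s ((cube a r).indicator (fun _ => (1 : ℝ)))) ≤ D := by
    rw [← hD]
    exact le_iSup_of_le a (le_iSup_of_le r (le_iSup_of_le hr le_rfl))
  have hv0 : volume (cube a r) ^ (β / (n : ℝ)) ≠ 0 := by simp [h0, h1]
  have hv1 : volume (cube a r) ^ (β / (n : ℝ)) ≠ ∞ := by simp [h0, h1]
  rw [mul_comm, mul_one_div, ENNReal.div_le_iff hv0 hv1] at h3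
  have h4 : ∫⁻ y in cube a r, ‖b y - m‖ₑ ≤ ENNReal.ofReal (K * D * r ^ (n + β)) := by
    rw [ENNReal.div_le_iff h0 h1] at h2
    refine h2.trans ((mul_le_mul_left (mul_le_mul_right h3 _) _).trans_eq ?_)
    rw [volume_cube_rpow hn a hr, volume_cube, Real.rpow_add hr, Real.rpow_natCast,
      ENNReal.ofReal_mul (by positivity), ENNReal.ofReal_mul (by positivity),
      ENNReal.ofReal_mul (by positivity), ENNReal.ofReal_pow hr.le, ENNReal.ofReal_coe_nnreal,
      ENNReal.ofReal_coe_nnreal]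
    ring
  rw [← ENNReal.ofReal_le_ofReal_iff (by positivity)]
  refine le_trans (le_of_eq ?_) h4
  have hint : IntegrableOn (fun y => b y - m) (cube a r) volume :=
    (integrableOn_cube hb a r).sub (integrableOn_const h1)
  exact ofReal_integral_norm_eq_lintegral_enorm hint

theorem exists_classBPair (hn : 0 < n) (hγ0 : 0 < γ) (hγn : γ < n) :
    ∃ p q : Rn n → ℝ, ClassBPair γ p q := by
  have hn' : (0 : ℝ) < n := by exact_mod_cast hn
  have h1 : 0 < (n : ℝ) - γ := by linarith
  refine ⟨fun _ => 2 * n / (n + γ), fun _ => 2 * n / (n - γ), classP_const ?_, ?_, fun x => ?_, ?_⟩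
  · rw [one_lt_div (by positivity)]; linarith
  · rw [upperExp, essSup_const _ (NeZero.ne _)]
    refine (ENNReal.ofReal_lt_ofReal_iff (by positivity)).2 ?_
    rw [div_lt_div_iff₀ (by positivity) hγ0]
    nlinarith
  · field_simp; ring
  · convert classB_two hn using 2 with x
    field_simp

end Commutator

end VarLebesgue

open VarLebesgue in
theorem theorem1p3 (n : ℕ) (α β : ℝ) (hβ0 : 0 < β) (hβ1 : β < 1) (hα0 : 0 < α)
    (hαn : α < (n : ℝ)) (hαβ : α + β < (n : ℝ))
    (b : Rn n → ℝ) (hb : MeasureTheory.LocallyIntegrable b MeasureTheory.volume) :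
    List.TFAE [
      MemLip β b,
      ∃ p q : Rn n → ℝ, ClassBPair (α + β) p q ∧ BoundedVar (maximalCommutator α b) p q,
      ∀ p q : Rn n → ℝ, ClassBPair (α + β) p q → BoundedVar (maximalCommutator α b) p q,
      ∃ s : Rn n → ℝ, ClassB s ∧ oscSup β b s < ⊤,
      ∀ s : Rn n → ℝ, ClassB s → oscSup β b s < ⊤] := by
  have hn : 0 < n := by exact_mod_cast hα0.trans hαn
  have hγ : 0 < α + β := by linarith
  tfae_have 1 → 3 := fun h p q hpq => h.boundedVar_maximalCommutator hn hα0 hβ0 hαβ hpq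
  tfae_have 3 → 2 := fun h => by
    obtain ⟨p, q, hpq⟩ := exists_classBPair hn hγ hαβ
    exact ⟨p, q, hpq, h p q hpq⟩
  tfae_have 2 → 4 := fun ⟨p, q, hpq, h⟩ =>
    ⟨q, hpq.classB_right hn hγ.le hαβ, oscSup_lt_top_of_boundedVar hn hα0 hβ0 hαβ hb hpq h⟩
  tfae_have 4 → 1 := fun ⟨s, hs, h⟩ => memLip_of_oscSup_lt_top hn hβ0 hβ1.le hb hs h
  tfae_have 1 → 5 := fun h s hs => h.oscSup_lt_top hn hβ0 hb hs
  tfae_have 5 → 4 := fun h => ⟨_, classB_two hn, h _ (classB_two hn)⟩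
  tfae_finish
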